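/- Let $(M,g_M)$ be a Lorentzian $4$-manifold of signature $(-,+,+,+)$, let $K$ be a $k$-dimensional manifold, and let $g_P$ be a metric on $P=M\times K$ for which $P\to M$ is a Riemannian submersion with Riemannian fibres. Equivalently, there are Riemannian metrics $g_K=g_K(x)$ on $K$, $x\in M$, and a smooth one-form $A$ on $M$ with values in the vector fields on $K$ such that, for $X,Y\in TM$ and $U,V\in TK$, $$g_P(U,V)=g_K(U,V),\qquad g_P(X,V)=-g_K(A(X),V),\qquad g_P(X,Y)=g_M(X,Y)+g_K(A(X),A(Y)).$$ Write $A(X)=\sum_a A^a(X)\,e_a$ with vector fields $e_a$ on $K$ (for each tangent vector $X$ a finite sum). The basic horizontal lift of a vector field $Y$ on $M$ is $Y^{\mathcal H}=Y+A(Y)$. Put $$F_A(X,Y)=\partial_X(A(Y))-\partial_Y(A(X))-A([X,Y])+[A(X),A(Y)],$$ a vector field on the fibres ($F_A=F_A^a e_a$ in components), and, for vertical fields $U,V$, $$(\mathrm d^Ag_K)_X(U,V)=(\mathcal L_Xg_K)(U,V)+A^a(X)\,(\mathcal L_{e_a}g_K)(U,V).$$ Let $\gamma_\mu$ ($4\times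 4$) and $\rho_j$ ($2^{[k/2]}\times 2^{[k/2]}$) be complex gamma matrices with $\{\gamma_\mu,\gamma_\nu\}=-2\eta_{\mu\nu}$, $\{\rho_i,\rho_j\}=-2\delta_{ij}$, and let $\gamma_5=i\gamma_0\gamma_1\gamma_2\gamma_3$. Fix spin structures on $M$ and on the vertical bundle $\mathscr V=\ker(TP\to TM)$. The spinor bundle of $P$ is $\pi^*S_{\mathbb C}(M)\otimes S_{\mathbb C}(\mathscr V)$, on which $X^{\mathcal H}$ acts by $X\cdot{}\otimes 1$ and a vertical $U$ by $\gamma_5\otimes U\cdot{}$. In the trivialization induced by an orthonormal frame $\{u_r\}$ of a semi-Riemannian spin manifold with metric $g$, the spinor covariant derivative is $$\nabla_X\Psi=\partial_X\Psi+\tfrac14\,g^{ir}g^{js}\,g(\nabla_Xu_i,u_j)\,u_r\cdot u_s\cdot\Psi$$ and the Kosmann–Lichnerowicz derivative is $$\mathscr L_X\Psi=\nabla_X\Psi-\tfrac18\,g^{ir}g^{js}\big[g(\nabla_{u_r}X,u_s)-g(\nabla_{u_s}X,u_r)\big]\,u_i\cdot u_j\cdot\Psi,$$ where $\nabla$ on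 vector fields is the Levi-Civita connection of $g$. Let $\varphi$ be a spinor on $M$, $\varphi^{\mathcal H}$ its basic lift (pullback) to $P$, $\psi$ a vertical spinor on $P$, and $\Psi=\varphi^{\mathcal H}\otimes\psi$. Let $\{X_\mu\}$ be a local $g_M$-orthonormal frame of $TM$ and $\{v_j\}$ a local $g_K$-orthonormal frame of $\mathscr V$ belonging to the spin structures. Then, in the trivialization induced by the frame $\{X_\mu^{\mathcal H},v_j\}$ of $TP$, the following hold (repeated indices are summed). (1) For every vertical vector field $U$ on $P$, $$\nabla_U\Psi=\varphi^{\mathcal H}\otimes\nabla_U\psi-\tfrac18\,g_M^{\mu\nu}g_M^{\sigma\rho}\,g_K(F_A(X_\mu,X_\sigma),U)\,(X_\nu\cdot X_\rho\cdot\varphi)^{\mathcal H}\otimes\psi+\tfrac14\,g_M^{\mu\nu}g_K^{ij}\,(\mathrm d^Ag_K)_{X_\mu}(U,v_i)\,(X_\nu\cdot\gamma_5\cdot\varphi)^{\mathcal H}\otimes(v_j\cdot\psi),$$ where $\nabla_U\psi$ is the spinor covariant derivative on the fibre $(K,g_K(x))$. (2) For every vector field $Y$ on $M$, $$\begin{aligned}\nabla_{Y^{\mathcal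 H}}\Psi={}&(\nabla^M_Y\varphi)^{\mathcal H}\otimes\psi+A^a(Y)\,\varphi^{\mathcal H}\otimes\mathscr L_{e_a}\psi+\tfrac14\,g_M^{\mu\nu}\,(X_\nu\cdot\gamma_5\cdot\varphi)^{\mathcal H}\otimes\big(F_A(Y,X_\mu)\cdot\psi\big)\\&+\varphi^{\mathcal H}\otimes\Big(\partial_Y\psi+\tfrac18\,g_K^{ir}g_K^{js}\big\{g_P([Y,v_i],v_j)-g_P([Y,v_j],v_i)\big\}\,v_r\cdot v_s\cdot\psi\Big),\end{aligned}$$ where $\nabla^M$ is the spinor covariant derivative on $(M,g_M)$, $\mathscr L_{e_a}\psi$ is the Kosmann–Lichnerowicz derivative on the fibre $(K,g_K(x))$, and $Y$ in the last line is regarded as a vector field on $P=M\times K$. -/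

import Mathlib

open Bundle VectorField FiberBundle
open scoped Manifold ContDiff

noncomputable section

section LeviCivita

variable {E : Type*} [NormedAddCommGroup E] [NormedSpace ℝ E]
  {H : Type*} [TopologicalSpace H] {I : ModelWithCorners ℝ E H}
  {B : Type*} [TopologicalSpace B] [ChartedSpace H B] [IsManifold I ∞ B]

variable (I B) in
/-- A smooth semi-Riemannian metric (of any signature). -/
structure SemiRiemannianMetric where
  /-- the bilinear form on each tangent space -/
  val (b : B) : TangentSpace I b →L[ℝ] TangentSpace I b →L[ℝ] ℝ
  symm (b : B) (v w : TangentSpace I b) : val b v w = val b w v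
  nondegenerate (b : B) (v : TangentSpace I b) (h : ∀ w, val b v w = 0) : v = 0
  contMDiff : ContMDiff I (I.prod 𝓘(ℝ, E →L[ℝ] E →L[ℝ] ℝ)) ∞
    (fun b ↦ TotalSpace.mk' (E →L[ℝ] E →L[ℝ] ℝ) b (val b))

namespace SemiRiemannianMetric

variable (g : SemiRiemannianMetric I B)

/-- The function `g(X, Y)`. -/
def ip (X Y : Π b : B, TangentSpace I b) (b : B) : ℝ := g.val b (X b) (Y b)

lemma mdiffAt_ip {X Y : Π b : B, TangentSpace I b} {b : B}
    (hX : MDiffAt (T% X) b) (hY : MDiffAt (T% Y) b) : MDiffAt (g.ip X Y) b := by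
  have : MDifferentiableAt I (I.prod 𝓘(ℝ))
      (fun m ↦ TotalSpace.mk' ℝ (E := Bundle.Trivial B ℝ) m (g.val m (X m) (Y m))) b := by
    apply MDifferentiableAt.clm_bundle_apply₂ (F₁ := E) (F₂ := E)
    · exact g.contMDiff.mdifferentiableAt (by simp)
    · exact hX
    · exact hY
  simp only [mdifferentiableAt_totalSpace] at this
  exact this.2

/-- The Koszul expression, equal to `2 g(∇_X Y, Z)` for the Levi-Civita connection. -/
def koszul (X Y Z : Π b : B, TangentSpace I b) (b : B) : ℝ :=
  d% (g.ip Y Z) b (X b) + d% (g.ip X Z) b (Y b) - d% (g.ip X Y) b (Z b)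
    + g.val b (mlieBracket I X Y b) (Z b) - g.val b (mlieBracket I X Z b) (Y b)
    - g.val b (mlieBracket I Y Z b) (X b)

lemma ip_add_left (X X' Y : Π b : B, TangentSpace I b) :
    g.ip (X + X') Y = g.ip X Y + g.ip X' Y := by ext b; simp [ip]
lemma ip_add_right (X Y Y' : Π b : B, TangentSpace I b) :
    g.ip X (Y + Y') = g.ip X Y + g.ip X Y' := by ext b; simp [ip]
lemma ip_smul_left (f : B → ℝ) (X Y : Π b : B, TangentSpace I b) :
    g.ip (f • X) Y = f * g.ip X Y := by ext b; simp [ip]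
lemma ip_smul_right (f : B → ℝ) (X Y : Π b : B, TangentSpace I b) :
    g.ip X (f • Y) = f * g.ip X Y := by ext b; simp [ip]
lemma ip_comm (X Y : Π b : B, TangentSpace I b) : g.ip X Y = g.ip Y X := by
  ext b; exact g.symm b _ _

lemma ext_of_forall_field {b : B} {v w : TangentSpace I b}
    (h : ∀ Z : Π b : B, TangentSpace I b, MDiffAt (T% Z) b →
      g.val b v (Z b) = g.val b w (Z b)) : v = w := by
  rw [← sub_eq_zero]
  refine g.nondegenerate b _ fun z ↦ ?_
  have := h (extend E z) (mdifferentiableAt_extend ..)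
  simp only [extend_apply_self] at this
  simp [this]

variable [FiniteDimensional ℝ E]

lemma koszul_tensorial_left {Y Z : Π b : B, TangentSpace I b} {b : B}
    (hY : MDiffAt (T% Y) b) (hZ : MDiffAt (T% Z) b) :
    TensorialAt I E (fun X ↦ g.koszul X Y Z b) b where
  smul {f X} hf hX := by
    have h1 := g.mdiffAt_ip hX hZ
    have h2 := g.mdiffAt_ip hX hY
    simp only [koszul, ip_smul_left, mvfderiv_mul hf h1, mvfderiv_mul hf h2,
      mlieBracket_smul_left hf hX]
    simp [ip]
    ring
  add {X X'} hX hX' := by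
    have h1 := g.mdiffAt_ip hX hZ
    have h2 := g.mdiffAt_ip hX hY
    have h1' := g.mdiffAt_ip hX' hZ
    have h2' := g.mdiffAt_ip hX' hY
    simp only [koszul, ip_add_left, mvfderiv_add h1 h1', mvfderiv_add h2 h2',
      mlieBracket_add_left hX hX']
    simp
    ring

lemma koszul_tensorial_right {X Y : Π b : B, TangentSpace I b} {b : B}
    (hX : MDiffAt (T% X) b) (hY : MDiffAt (T% Y) b) :
    TensorialAt I E (fun Z ↦ g.koszul X Y Z b) b where
  smul {f Z} hf hZ := by
    have h1 := g.mdiffAt_ip hX hZ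
    have h2 := g.mdiffAt_ip hY hZ
    simp only [koszul, ip_smul_right, mvfderiv_mul hf h1, mvfderiv_mul hf h2,
      mlieBracket_smul_right hf hZ]
    simp [ip, g.symm b (Z b) (X b), g.symm b (Z b) (Y b)]
    ring
  add {Z Z'} hZ hZ' := by
    have h1 := g.mdiffAt_ip hX hZ
    have h2 := g.mdiffAt_ip hY hZ
    have h1' := g.mdiffAt_ip hX hZ'
    have h2' := g.mdiffAt_ip hY hZ'
    simp only [koszul, ip_add_right, mvfderiv_add h1 h1', mvfderiv_add h2 h2',
      mlieBracket_add_right hZ hZ']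
    simp
    ring

lemma koszul_add_mid {X Y Y' Z : Π b : B, TangentSpace I b} {b : B}
    (hX : MDiffAt (T% X) b) (hY : MDiffAt (T% Y) b) (hY' : MDiffAt (T% Y') b)
    (hZ : MDiffAt (T% Z) b) :
    g.koszul X (Y + Y') Z b = g.koszul X Y Z b + g.koszul X Y' Z b := by
  simp only [koszul, ip_add_left, ip_add_right,
    mvfderiv_add (g.mdiffAt_ip hY hZ) (g.mdiffAt_ip hY' hZ),
    mvfderiv_add (g.mdiffAt_ip hX hY) (g.mdiffAt_ip hX hY'),
    mlieBracket_add_left hY hY', mlieBracket_add_right hY hY']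
  simp
  ring

lemma koszul_smul_mid {f : B → ℝ} {X Y Z : Π b : B, TangentSpace I b} {b : B}
    (hf : MDiffAt f b) (hX : MDiffAt (T% X) b) (hY : MDiffAt (T% Y) b) (hZ : MDiffAt (T% Z) b) :
    g.koszul X (f • Y) Z b
      = f b * g.koszul X Y Z b + 2 * (d% f b (X b) * g.val b (Y b) (Z b)) := by
  simp only [koszul, ip_smul_left, ip_smul_right, mvfderiv_mul hf (g.mdiffAt_ip hY hZ),
    mvfderiv_mul hf (g.mdiffAt_ip hX hY), mlieBracket_smul_left hf hY,
    mlieBracket_smul_right hf hY]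
  simp [ip, g.symm b (Y b) (X b)]
  ring

/-- The bilinear form `(v, w) ↦ 2 g(∇_v Y, w)` at a point where `Y` is differentiable. -/
def koszulForm (Y : Π b : B, TangentSpace I b) (b : B) (hY : MDiffAt (T% Y) b) :
    TangentSpace I b →L[ℝ] TangentSpace I b →L[ℝ] ℝ :=
  TensorialAt.mkHom₂ (fun X Z ↦ g.koszul X Y Z b) b
    (fun _ hZ ↦ g.koszul_tensorial_left hY hZ) (fun _ hX ↦ g.koszul_tensorial_right hX hY)

lemma koszulForm_apply {X Y Z : Π b : B, TangentSpace I b} {b : B}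
    (hX : MDiffAt (T% X) b) (hY : MDiffAt (T% Y) b) (hZ : MDiffAt (T% Z) b) :
    g.koszulForm Y b hY (X b) (Z b) = g.koszul X Y Z b :=
  TensorialAt.mkHom₂_apply _ _ hX hZ

/-- The vector dual to a covector. -/
lemma exists_sharp (b : B) : ∃ L : (TangentSpace I b →L[ℝ] ℝ) →L[ℝ] TangentSpace I b,
    ∀ l w, g.val b (L l) w = l w := by
  suffices key : ∀ f : E →L[ℝ] E →L[ℝ] ℝ, (∀ v, (∀ w, f v w = 0) → v = 0) →
      ∃ L : (E →L[ℝ] ℝ) →L[ℝ] E, ∀ l w, f (L l) w = l w from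
    key (g.val b) (g.nondegenerate b)
  intro f hf
  have hinj : Function.Injective (f : E →ₗ[ℝ] E →L[ℝ] ℝ) := by
    rw [← LinearMap.ker_eq_bot, LinearMap.ker_eq_bot']
    intro v hv
    exact hf v fun w ↦ by simpa using congrArg (fun l : E →L[ℝ] ℝ ↦ l w) hv
  have hrank : Module.finrank ℝ E = Module.finrank ℝ (E →L[ℝ] ℝ) := by
    rw [← (LinearMap.toContinuousLinearMap : (E →ₗ[ℝ] ℝ) ≃ₗ[ℝ] E →L[ℝ] ℝ).finrank_eq]
    exact (Subspace.dual_finrank_eq (K := ℝ) (V := E)).symm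
  let e := LinearEquiv.ofInjectiveOfFinrankEq (f : E →ₗ[ℝ] E →L[ℝ] ℝ) hinj hrank
  refine ⟨LinearMap.toContinuousLinearMap (e.symm : (E →L[ℝ] ℝ) →ₗ[ℝ] E), fun l w ↦ ?_⟩
  exact congrArg (fun l : E →L[ℝ] ℝ ↦ l w) (e.apply_symm_apply l)

/-- A connection on the tangent bundle is compatible with `g` when
`X g(Y, Z) = g(∇_X Y, Z) + g(Y, ∇_X Z)`. -/
def IsCompatible (cov : CovariantDerivative I E (TangentSpace I : B → Type _)) : Prop :=
  ∀ (b : B) (X Y Z : Π b : B, TangentSpace I b), MDiffAt (T% Y) b → MDiffAt (T% Z) b →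
    d% (g.ip Y Z) b (X b)
      = g.val b (cov Y b (X b)) (Z b) + g.val b (Y b) (cov Z b (X b))

/-- The fundamental theorem of semi-Riemannian geometry (existence). -/
theorem exists_leviCivita : ∃ cov : CovariantDerivative I E (TangentSpace I : B → Type _),
    cov.torsion = 0 ∧ g.IsCompatible cov := by
  classical
  choose L hL using fun b ↦ g.exists_sharp b
  let c : (Π b : B, TangentSpace I b) → Π b : B, TangentSpace I b →L[ℝ] TangentSpace I b :=
    fun Y b ↦ if hY : MDiffAt (T% Y) b then (1 / 2 : ℝ) • (L b).comp (g.koszulForm Y b hY) else 0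
  have hc : ∀ {X Y Z : Π b : B, TangentSpace I b} {b : B}, MDiffAt (T% X) b → MDiffAt (T% Y) b →
      MDiffAt (T% Z) b → g.val b (c Y b (X b)) (Z b) = 1 / 2 * g.koszul X Y Z b := by
    intro X Y Z b hX hY hZ
    simp only [c, dif_pos hY]
    rw [← g.koszulForm_apply hX hY hZ]
    have := hL b (g.koszulForm Y b hY (X b)) (Z b)
    simp [this]
  have hcc : ∀ {b : B} {f f' : TangentSpace I b →L[ℝ] TangentSpace I b},
      (∀ X Z : Π b : B, TangentSpace I b, MDiffAt (T% X) b → MDiffAt (T% Z) b →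
        g.val b (f (X b)) (Z b) = g.val b (f' (X b)) (Z b)) → f = f' := by
    intro b f f' h
    ext v
    refine g.ext_of_forall_field fun Z hZ ↦ ?_
    have := h (extend E v) Z (mdifferentiableAt_extend ..) hZ
    simpa only [extend_apply_self] using this
  have hcov : IsCovariantDerivativeOn E c Set.univ := by
    constructor
    · intro Y Y' b hY hY' _
      refine hcc fun X Z hX hZ ↦ ?_
      rw [hc hX (mdifferentiableAt_add_section hY hY') hZ, g.koszul_add_mid hX hY hY' hZ]
      simp [hc hX hY hZ, hc hX hY' hZ]
      ring
    · intro Y f b hY hf _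
      refine hcc fun X Z hX hZ ↦ ?_
      rw [hc hX (hf.smul_section hY) hZ, g.koszul_smul_mid hf hX hY hZ]
      simp [hc hX hY hZ]
      ring
  let cov : CovariantDerivative I E (TangentSpace I : B → Type _) := ⟨c, hcov⟩
  have hc' : ∀ {X Y Z : Π b : B, TangentSpace I b} {b : B}, MDiffAt (T% X) b → MDiffAt (T% Y) b →
      MDiffAt (T% Z) b → g.val b (cov Y b (X b)) (Z b) = 1 / 2 * g.koszul X Y Z b := hc
  refine ⟨cov, ?_, ?_⟩
  · rw [CovariantDerivative.torsion_eq_zero_iff]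
    intro X Y b hX hY
    refine g.ext_of_forall_field fun Z hZ ↦ ?_
    simp only [map_sub, sub_apply, hc' hX hY hZ, hc' hY hX hZ]
    simp only [koszul, g.ip_comm Y X, mlieBracket_swap_apply (V := Y) (W := X)]
    simp
    ring
  · intro b X Y Z hY hZ
    have hX := mdifferentiableAt_extend I E (X b)
    have h1 := hc' hX hY hZ
    have h2 := hc' hX hZ hY
    simp only [extend_apply_self] at h1 h2
    rw [g.symm b (Y b), h1, h2]
    simp only [koszul, g.ip_comm Z Y, mlieBracket_swap_apply (V := Z) (W := Y), extend_apply_self]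
    simp
    ring

/-- The Levi-Civita connection of `g`. -/
def leviCivita : CovariantDerivative I E (TangentSpace I : B → Type _) :=
  g.exists_leviCivita.choose

lemma torsion_leviCivita : g.leviCivita.torsion = 0 := g.exists_leviCivita.choose_spec.1

lemma isCompatible_leviCivita : g.IsCompatible g.leviCivita := g.exists_leviCivita.choose_spec.2

end SemiRiemannianMetric
end LeviCivita

/-! ### Spin structures, spinors and their derivatives -/

section Spin

open scoped Kronecker

/-- The quadratic form `v ↦ -∑ ε i * v i ^ 2`. With it, Clifford multiplication satisfies
`v · v = -g(v, v)` for the inner product `g` with diagonal entries `ε`. -/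
def cliffordForm {n : Type*} [Fintype n] (ε : n → ℝ) : QuadraticForm ℝ (n → ℝ) :=
  QuadraticMap.weightedSumSquares ℝ (fun i ↦ -ε i)

/-- Gamma matrices of a representation of the Clifford algebra. -/
def gammaMatrix {n N : Type*} [Fintype n] [DecidableEq n] [Fintype N] [DecidableEq N] {ε : n → ℝ}
    (ρ : CliffordAlgebra (cliffordForm ε) →ₐ[ℝ] Matrix N N ℂ) (i : n) : Matrix N N ℂ :=
  ρ (CliffordAlgebra.ι (cliffordForm ε) (Pi.single i 1))

variable {E : Type*} [NormedAddCommGroup E] [NormedSpace ℝ E]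
  {H : Type*} [TopologicalSpace H] {I : ModelWithCorners ℝ E H}
  {B : Type*} [TopologicalSpace B] [ChartedSpace H B] [IsManifold I ∞ B]
  {n N : Type*} [Fintype n] [DecidableEq n] [Fintype N] [DecidableEq N]

/-- A spin structure on a subbundle `D` of `TB` with fibre metric `g` of signature `ε`, given by
smooth orthonormal frames of `D` over an open cover of `B` together with a smooth lift of their
transition functions to a cocycle with values in the spin group. The local trivializations are
labelled by `Idx`. -/
structure SpinStructure (Idx : Type*) (D : Π b : B, Submodule ℝ (TangentSpace I b))
    (g : SemiRiemannianMetric I B) (ε : n → ℝ) where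
  /-- domains of the local trivializations -/
  dom : Idx → Set B
  isOpen_dom (α : Idx) : IsOpen (dom α)
  exists_mem_dom (b : B) : ∃ α, b ∈ dom α
  /-- the local frames -/
  frame : Idx → n → Π b : B, TangentSpace I b
  contMDiffOn_frame (α : Idx) (i : n) :
    ContMDiffOn I I.tangent ∞ (fun b ↦ (⟨b, frame α i b⟩ : TangentBundle I B)) (dom α)
  span_frame (α : Idx) (b : B) (hb : b ∈ dom α) :
    Submodule.span ℝ (Set.range fun i ↦ frame α i b) = D b
  orthonormal (α : Idx) (b : B) (hb : b ∈ dom α) (i j : n) :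
    g.val b (frame α i b) (frame α j b) = if i = j then ε i else 0
  /-- the transition functions -/
  trans : Idx → Idx → B → CliffordAlgebra (cliffordForm ε)
  trans_mem (α β : Idx) (b : B) (hα : b ∈ dom α) (hβ : b ∈ dom β) :
    trans α β b ∈ spinGroup (cliffordForm ε)
  contMDiffOn_trans (α β : Idx) (l : CliffordAlgebra (cliffordForm ε) →ₗ[ℝ] ℝ) :
    ContMDiffOn I 𝓘(ℝ) ∞ (fun b ↦ l (trans α β b)) (dom α ∩ dom β)
  /-- the transition function covers the change of frames -/
  trans_frame (α β : Idx) (b : B) (hα : b ∈ dom α) (hβ : b ∈ dom β) (v w : n → ℝ)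
    (h : ∑ i, w i • frame α i b = ∑ i, v i • frame β i b) :
    trans α β b * CliffordAlgebra.ι (cliffordForm ε) v
      = CliffordAlgebra.ι (cliffordForm ε) w * trans α β b
  cocycle (α β δ : Idx) (b : B) (hα : b ∈ dom α) (hβ : b ∈ dom β) (hδ : b ∈ dom δ) :
    trans α β b * trans β δ b = trans α δ b

/-- Smooth sections of the complex spinor bundle associated to a spin structure through the
representation `ρ`. -/
structure SpinorField {Idx : Type*} {D : Π b : B, Submodule ℝ (TangentSpace I b)}
    {g : SemiRiemannianMetric I B} {ε : n → ℝ} (S : SpinStructure Idx D g ε)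
    (ρ : CliffordAlgebra (cliffordForm ε) →ₐ[ℝ] Matrix N N ℂ) where
  /-- the representative in each local trivialization -/
  rep : Idx → B → N → ℂ
  contMDiffOn_rep (α : Idx) : ContMDiffOn I 𝓘(ℝ, N → ℂ) ∞ (rep α) (S.dom α)
  rep_trans (α β : Idx) (b : B) (hα : b ∈ S.dom α) (hβ : b ∈ S.dom β) :
    rep α b = (ρ (S.trans α β b)).mulVec (rep β b)

variable [FiniteDimensional ℝ E]

/-- Covariant derivative of a spinor in the trivialization induced by an orthonormal frame `u` with
`g(u i, u i) = ε i`, where `u i` acts on spinors by the matrix `Γ i`: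
`∇_X Ψ = ∂_X Ψ + 1/4 ∑ g^{ir} g^{js} g(∇_X u_i, u_j) u_r · u_s · Ψ`. -/
def spinDeriv (g : SemiRiemannianMetric I B) (ε : n → ℝ) (u : n → Π b : B, TangentSpace I b)
    (Γ : n → Matrix N N ℂ) (X : Π b : B, TangentSpace I b) (Ψ : B → N → ℂ) (b : B) : N → ℂ :=
  mvfderiv I Ψ b (X b) + (1 / 4 : ℝ) • ∑ i, ∑ j,
    (ε i * ε j * g.val b (g.leviCivita (u i) b (X b)) (u j b)) • (Γ i * Γ j).mulVec (Ψ b)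

/-- Kosmann-Lichnerowicz derivative of a spinor in the trivialization induced by an orthonormal
frame `u`:
`L_X Ψ = ∇_X Ψ - 1/8 ∑ g^{ir} g^{js} (g(∇_{u_r} X, u_s) - g(∇_{u_s} X, u_r)) u_i · u_j · Ψ`. -/
def kosmannDeriv (g : SemiRiemannianMetric I B) (ε : n → ℝ) (u : n → Π b : B, TangentSpace I b)
    (Γ : n → Matrix N N ℂ) (X : Π b : B, TangentSpace I b) (Ψ : B → N → ℂ) (b : B) : N → ℂ :=
  spinDeriv g ε u Γ X Ψ b - (1 / 8 : ℝ) • ∑ i, ∑ j,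
    (ε i * ε j * (g.val b (g.leviCivita X b (u i b)) (u j b)
      - g.val b (g.leviCivita X b (u j b)) (u i b))) • (Γ i * Γ j).mulVec (Ψ b)

/-- The matrix by which a tangent vector acts on spinors (Clifford multiplication) in the
trivialization induced by an orthonormal frame `u`. -/
def cliffordMul (g : SemiRiemannianMetric I B) (ε : n → ℝ) (u : n → Π b : B, TangentSpace I b)
    (Γ : n → Matrix N N ℂ) (b : B) (v : TangentSpace I b) : Matrix N N ℂ :=
  ∑ i, (ε i * g.val b v (u i b)) • Γ i

/-- Lie derivative of a metric, `(L_X g)(V, W) = X(g(V, W)) - g([X, V], W) - g(V, [X, W])`. -/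
def lieDerivMetric (g : SemiRiemannianMetric I B) (X V W : Π b : B, TangentSpace I b) (b : B) : ℝ :=
  d% (g.ip V W) b (X b) - g.val b (mlieBracket I X V b) (W b) - g.val b (V b) (mlieBracket I X W b)

end Spin

/-! ### Submersive metrics on a product -/

section Submersion

open scoped Kronecker

variable {EM : Type*} [NormedAddCommGroup EM] [NormedSpace ℝ EM]
  {HM : Type*} [TopologicalSpace HM] {IM : ModelWithCorners ℝ EM HM}
  {M : Type*} [TopologicalSpace M] [ChartedSpace HM M] [IsManifold IM ∞ M]
  {EK : Type*} [NormedAddCommGroup EK] [NormedSpace ℝ EK]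
  {HK : Type*} [TopologicalSpace HK] {IK : ModelWithCorners ℝ EK HK}
  {K : Type*} [TopologicalSpace K] [ChartedSpace HK K] [IsManifold IK ∞ K]

/-- Signature of a Lorentzian metric in dimension four. -/
def minkowski : Fin 4 → ℝ := ![-1, 1, 1, 1]

/-- Signature of a Riemannian metric in dimension `k`. -/
def euclidean (k : ℕ) : Fin k → ℝ := fun _ ↦ 1

/-- A vector field on `M`, regarded as a vector field on `M × K`. -/
def liftBase (X : Π x : M, TangentSpace IM x) (p : M × K) : TangentSpace (IM.prod IK) p :=
  ((X p.1, 0) : EM × EK)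

/-- The vertical part of a vector field on `M × K` in the decomposition `TM ⊕ TK`, restricted to
the fibre over `x`. -/
def restrictFibre (W : Π p : M × K, TangentSpace (IM.prod IK) p) (x : M) (y : K) :
    TangentSpace IK y :=
  (W (x, y) : EM × EK).2

/-- The vertical bundle, the kernel of `TP → TM`. -/
def vertical (IM : ModelWithCorners ℝ EM HM) (IK : ModelWithCorners ℝ EK HK) (p : M × K) :
    Submodule ℝ (TangentSpace (IM.prod IK) p) :=
  LinearMap.ker (LinearMap.fst ℝ EM EK)

variable (IM M IK K) in
/-- A metric on `P = M × K` for which the projection to the Lorentzian four-manifold `M` is a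
Riemannian submersion, together with the triple `(gM, gK, A)` equivalent to it. -/
structure SubmersiveMetric where
  /-- the metric on the base -/
  gM : SemiRiemannianMetric IM M
  lorentzian (x : M) : ∃ e : Module.Basis (Fin 4) ℝ (TangentSpace IM x),
    ∀ i j, gM.val x (e i) (e j) = if i = j then minkowski i else 0
  /-- the metrics on the fibres -/
  gK : M → SemiRiemannianMetric IK K
  riemannian (x : M) (y : K) (v : TangentSpace IK y) (hv : v ≠ 0) : 0 < (gK x).val y v v
  /-- the one-form on `M` with values in vector fields on `K` -/
  A (p : M × K) : TangentSpace IM p.1 →L[ℝ] TangentSpace IK p.2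
  contMDiff_A : ContMDiff (IM.prod IK)
    ((IM.prod IK).prod 𝓘(ℝ, (EM × EK) →L[ℝ] (EM × EK))) ∞
    (fun p : M × K ↦ TotalSpace.mk' ((EM × EK) →L[ℝ] (EM × EK))
      (E := fun p ↦ TangentSpace (IM.prod IK) p →L[ℝ] TangentSpace (IM.prod IK) p) p
      ((ContinuousLinearMap.inr ℝ EM EK).comp
        ((A p : EM →L[ℝ] EK).comp (ContinuousLinearMap.fst ℝ EM EK))))
  /-- the metric on the total space -/
  gP : SemiRiemannianMetric (IM.prod IK) (M × K)
  gP_vertical (p : M × K) (u v : EK) : gP.val p ((0, u) : EM × EK) ((0, v) : EM × EK)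
    = (gK p.1).val p.2 u v
  gP_mixed (p : M × K) (w : EM) (v : EK) : gP.val p ((w, 0) : EM × EK) ((0, v) : EM × EK)
    = -(gK p.1).val p.2 (A p w) v
  gP_base (p : M × K) (w z : EM) : gP.val p ((w, 0) : EM × EK) ((z, 0) : EM × EK)
    = gM.val p.1 w z + (gK p.1).val p.2 (A p w) (A p z)

/-- `γ₅ = i γ₀ γ₁ γ₂ γ₃`. -/
def gammaFive {N : Type*} [Fintype N] [DecidableEq N]
    (γ : CliffordAlgebra (cliffordForm minkowski) →ₐ[ℝ] Matrix N N ℂ) : Matrix N N ℂ :=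
  Complex.I • (gammaMatrix γ 0 * gammaMatrix γ 1 * gammaMatrix γ 2 * gammaMatrix γ 3)

/-- The higher-dimensional gamma matrices `γ_μ ⊗ 1` and `γ₅ ⊗ ρ_j`. -/
def gammaProd {N N' : Type*} [Fintype N] [DecidableEq N] [Fintype N'] [DecidableEq N'] {k : ℕ}
    (γ : CliffordAlgebra (cliffordForm minkowski) →ₐ[ℝ] Matrix N N ℂ)
    (ρ : CliffordAlgebra (cliffordForm (euclidean k)) →ₐ[ℝ] Matrix N' N' ℂ) :
    Fin 4 ⊕ Fin k → Matrix (N × N') (N × N') ℂ :=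
  Sum.elim (fun μ ↦ gammaMatrix γ μ ⊗ₖ 1) (fun j ↦ gammaFive γ ⊗ₖ gammaMatrix ρ j)

/-- The tensor product of two spinors at a point. -/
def spinorTensor {N N' : Type*} (φ : N → ℂ) (ψ : N' → ℂ) : N × N' → ℂ := fun q ↦ φ q.1 * ψ q.2

namespace SubmersiveMetric

variable (G : SubmersiveMetric IM M IK K)

/-- The vector field `A(X)` on the fibre over `x`. -/
def gauge (X : Π x : M, TangentSpace IM x) (x : M) (y : K) : TangentSpace IK y :=
  G.A (x, y) (X x)

/-- The basic horizontal lift `X + A(X)` of a vector field on `M`. -/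
def horizontalLift (X : Π x : M, TangentSpace IM x) (p : M × K) : TangentSpace (IM.prod IK) p :=
  ((X p.1, G.A p (X p.1)) : EM × EK)

/-- The derivative `∂_X (A(Y))`, taken along `M` in the fixed vector space `T_y K`. -/
def derivGauge (X Y : Π x : M, TangentSpace IM x) (p : M × K) : TangentSpace IK p.2 :=
  mvfderiv (F := EK) IM (fun x : M ↦ G.gauge Y x p.2) p.1 (X p.1)

/-- The curvature `F_A(X, Y) = (dA)(X, Y) + [A(X), A(Y)]`, with
`(dA)(X, Y) = ∂_X (A(Y)) - ∂_Y (A(X)) - A([X, Y])`. -/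
def curvature (X Y : Π x : M, TangentSpace IM x) (p : M × K) : TangentSpace IK p.2 :=
  G.derivGauge X Y p - G.derivGauge Y X p - G.A p (mlieBracket IM X Y p.1)
    + mlieBracket IK (G.gauge X p.1) (G.gauge Y p.1) p.2

/-- The Lie derivative `(L_X gK)(U, V)` of the family of fibre metrics along a vector field `X` on
`M`, for vertical vector fields `U`, `V` on `M × K`. -/
def lieDerivBase (X : Π x : M, TangentSpace IM x)
    (U V : Π p : M × K, TangentSpace (IM.prod IK) p) (p : M × K) : ℝ :=
  mvfderiv (IM.prod IK)
      (fun q : M × K ↦ (G.gK q.1).ip (restrictFibre U q.1) (restrictFibre V q.1) q.2) p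
      (liftBase X p)
    - (G.gK p.1).val p.2
        (restrictFibre (mlieBracket (IM.prod IK) (liftBase X) U) p.1 p.2)
        (restrictFibre V p.1 p.2)
    - (G.gK p.1).val p.2 (restrictFibre U p.1 p.2)
        (restrictFibre (mlieBracket (IM.prod IK) (liftBase X) V) p.1 p.2)

/-- The covariant derivative `(d^A gK)_X (U, V) = (L_X gK)(U, V) + (L_{A(X)} gK)(U, V)`. The second
Lie derivative is taken on the fibre; it equals `A^a(X) (L_{e_a} gK)(U, V)` when
`A(X) = A^a(X) e_a`. -/
def covDerivMetric (X : Π x : M, TangentSpace IM x)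
    (U V : Π p : M × K, TangentSpace (IM.prod IK) p) (p : M × K) : ℝ :=
  G.lieDerivBase X U V p
    + lieDerivMetric (G.gK p.1) (G.gauge X p.1) (restrictFibre U p.1) (restrictFibre V p.1) p.2

/-! ### Spinors on `M × K` -/

variable {N N' : Type*} [Fintype N] [DecidableEq N] [Fintype N'] [DecidableEq N'] {k : ℕ}
  {Idx Idx' : Type*}
  {SM : SpinStructure Idx (fun _ ↦ ⊤) G.gM minkowski}
  {SV : SpinStructure Idx' (vertical IM IK) G.gP (euclidean k)}
  {γ : CliffordAlgebra (cliffordForm minkowski) →ₐ[ℝ] Matrix N N ℂ}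
  {ρ : CliffordAlgebra (cliffordForm (euclidean k)) →ₐ[ℝ] Matrix N' N' ℂ}

/-- The orthonormal frame of `TP` consisting of the basic lifts of a frame of `TM` and of a frame of
the vertical bundle. -/
def adaptedFrame (SM : SpinStructure Idx (fun _ ↦ ⊤) G.gM minkowski)
    (SV : SpinStructure Idx' (vertical IM IK) G.gP (euclidean k)) (α : Idx) (β : Idx') :
    Fin 4 ⊕ Fin k → Π p : M × K, TangentSpace (IM.prod IK) p :=
  Sum.elim (fun μ ↦ G.horizontalLift (SM.frame α μ)) (fun j ↦ SV.frame β j)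

/-- Smooth sections of the spinor bundle of `P`, realised as the tensor product of the pullback of
the spinor bundle of `M` (the spinor bundle of the horizontal bundle) with the spinor bundle of the
vertical bundle. The trivialization labelled by `α` and `β` is the one induced by the adapted frame;
the frame vectors act in it by the matrices `gammaProd`. -/
structure TotalSpinor (SM : SpinStructure Idx (fun _ ↦ ⊤) G.gM minkowski)
    (SV : SpinStructure Idx' (vertical IM IK) G.gP (euclidean k))
    (γ : CliffordAlgebra (cliffordForm minkowski) →ₐ[ℝ] Matrix N N ℂ)
    (ρ : CliffordAlgebra (cliffordForm (euclidean k)) →ₐ[ℝ] Matrix N' N' ℂ) where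
  /-- the representative in each local trivialization -/
  rep : Idx → Idx' → M × K → N × N' → ℂ
  contMDiffOn_rep (α : Idx) (β : Idx') :
    ContMDiffOn (IM.prod IK) 𝓘(ℝ, N × N' → ℂ) ∞ (rep α β) (Prod.fst ⁻¹' SM.dom α ∩ SV.dom β)
  rep_trans (α α' : Idx) (β β' : Idx') (p : M × K) (hα : p.1 ∈ SM.dom α) (hα' : p.1 ∈ SM.dom α')
    (hβ : p ∈ SV.dom β) (hβ' : p ∈ SV.dom β') :
    rep α β p
      = (γ (SM.trans α α' p.1) ⊗ₖ ρ (SV.trans β β' p)).mulVec (rep α' β' p)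

/-- The spinor `φ^H ⊗ ψ` on `P`, for a spinor `φ` on `M` with basic lift `φ^H` and a vertical spinor
`ψ`. -/
def liftTensor (φ : SpinorField SM γ) (ψ : SpinorField SV ρ) : G.TotalSpinor SM SV γ ρ where
  rep α β p := spinorTensor (φ.rep α p.1) (ψ.rep β p)
  contMDiffOn_rep α β := by
    rw [contMDiffOn_pi_space]
    intro q
    have h1 := (contMDiffOn_pi_space.1 (φ.contMDiffOn_rep α)) q.1
    have h2 := (contMDiffOn_pi_space.1 (ψ.contMDiffOn_rep β)) q.2
    have h3 : ContMDiffOn (IM.prod IK) 𝓘(ℝ, ℂ) ∞ (fun p : M × K ↦ φ.rep α p.1 q.1)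
        (Prod.fst ⁻¹' SM.dom α ∩ SV.dom β) :=
      h1.comp contMDiff_fst.contMDiffOn fun p hp ↦ hp.1
    exact (contDiff_mul (𝕜 := ℝ) (𝔸 := ℂ)).contMDiff.comp_contMDiffOn
      (h3.prodMk_space (h2.mono Set.inter_subset_right))
  rep_trans α α' β β' p hα hα' hβ hβ' := by
    rw [φ.rep_trans α α' p.1 hα hα', ψ.rep_trans β β' p hβ hβ']
    ext q
    simp only [spinorTensor, Matrix.mulVec, dotProduct, Matrix.kroneckerMap_apply,
      Finset.sum_mul_sum, Fintype.sum_prod_type]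
    exact Finset.sum_congr rfl fun i _ ↦ Finset.sum_congr rfl fun j _ ↦ by ring

variable [FiniteDimensional ℝ EM] [FiniteDimensional ℝ EK]

/-- The spinor covariant derivative on `(P, gP)`, in the trivialization of an adapted frame. -/
def covDeriv (Ψ : G.TotalSpinor SM SV γ ρ) (W : Π p : M × K, TangentSpace (IM.prod IK) p)
    (α : Idx) (β : Idx') (p : M × K) : N × N' → ℂ :=
  spinDeriv G.gP (Sum.elim minkowski (euclidean k)) (G.adaptedFrame SM SV α β) (gammaProd γ ρ)
    W (Ψ.rep α β) p

/-- The spinor covariant derivative on `(M, gM)`. -/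
def baseDeriv (φ : SpinorField SM γ) (Y : Π x : M, TangentSpace IM x) (α : Idx) (x : M) : N → ℂ :=
  spinDeriv G.gM minkowski (SM.frame α) (gammaMatrix γ) Y (φ.rep α) x

/-- The covariant derivative of a vertical spinor, restricted to the fibre `(K, gK x)`, along a
vector field on `K`. -/
def fibreDeriv (ψ : SpinorField SV ρ) (V : Π y : K, TangentSpace IK y) (β : Idx') (p : M × K) :
    N' → ℂ :=
  spinDeriv (G.gK p.1) (euclidean k) (fun j ↦ restrictFibre (SV.frame β j) p.1) (gammaMatrix ρ)
    V (fun y ↦ ψ.rep β (p.1, y)) p.2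

/-- The Kosmann-Lichnerowicz derivative of a vertical spinor, restricted to the fibre `(K, gK x)`,
along a vector field on `K`. -/
def fibreKosmann (ψ : SpinorField SV ρ) (V : Π y : K, TangentSpace IK y) (β : Idx') (p : M × K) :
    N' → ℂ :=
  kosmannDeriv (G.gK p.1) (euclidean k) (fun j ↦ restrictFibre (SV.frame β j) p.1) (gammaMatrix ρ)
    V (fun y ↦ ψ.rep β (p.1, y)) p.2

/-- Clifford multiplication of a vertical spinor by a vertical vector. -/
def fibreClifford (ψ : SpinorField SV ρ) (β : Idx') (p : M × K) (v : TangentSpace IK p.2) :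
    N' → ℂ :=
  (cliffordMul (G.gK p.1) (euclidean k) (fun j ↦ restrictFibre (SV.frame β j) p.1) (gammaMatrix ρ)
    p.2 v).mulVec (ψ.rep β p)

end SubmersiveMetric
end Submersion
end

/-! In an orthonormal frame the spinor derivative along `W` is determined by the numbers `gP(∇_W
u_i, u_j)`. For the adapted frame of basic lifts and vertical fields, the Koszul formula reduces
these to derivatives of inner products and to Lie brackets, and the submersion structure makes most
of the terms vanish.

Completing the square gives `gP(a, b) = gM(a₁, b₁) + gK(a₂ - A a₁, b₂ - A b₁)`. Hence lifts are
orthogonal to vertical fields, and inner products of lifts are pulled back from `M`. The bracket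
`[X^H, Y^H]` projects to `[X, Y]` and has vertical part `F_A(X, Y)`, while `[X^H, V]` is vertical
and equals `[X, V] + [A(X), V]`. These brackets come from `mlieBracket_prod_fst` and
`mlieBracket_prod_snd`, which apply the commutator formula `mvfderiv_mlieBracket` to the chart maps
of the factors. What survives in the Koszul formula is the connection of `M`, the connection of the
fibre, half of `F_A`, half of `d^A gK`, and antisymmetrised brackets with the vertical frame.

On the Clifford side, `γ₅` anticommutes with every `γ_μ` and squares to one. The two kinds of mixed
terms therefore coincide, so their coefficient doubles from 1/4 to 1/2, and `γ₅` drops out of the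
vertical-vertical terms (`covDeriv_liftTensor`).

In formula (2), the brackets with `A(Y)` together with the derivative of `ψ` along `A(Y)` form a
Kosmann-Lichnerowicz derivative. In an orthonormal frame that derivative involves only Lie brackets
(`kosmannDeriv_eq`), so it is linear over real constants in the vector field. On one fibre the
coefficients of `A(Y)` in the `e a` are constants and can be pulled out. -/

open Set Filter Topology

/-! ### Calculus of vector-valued functions on manifolds. -/

section VectorValuedDerivative

variable {E : Type*} [NormedAddCommGroup E] [NormedSpace ℝ E]
  {H : Type*} [TopologicalSpace H] {I : ModelWithCorners ℝ E H}
  {B : Type*} [TopologicalSpace B] [ChartedSpace H B]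
  {E' : Type*} [NormedAddCommGroup E'] [NormedSpace ℝ E']
  {H' : Type*} [TopologicalSpace H'] {I' : ModelWithCorners ℝ E' H'}
  {B' : Type*} [TopologicalSpace B'] [ChartedSpace H' B']
  {F' : Type*} [NormedAddCommGroup F'] [NormedSpace ℝ F']
  {F : Type*} [NormedAddCommGroup F] [NormedSpace ℝ F]

/-- The derivative of a vector valued function, computed in the chart at a point. -/
lemma mvfderiv_eq_fderivWithin {f : B → F} {b : B} (hf : MDiffAt f b) (v : TangentSpace I b) :
    mvfderiv I f b v
      = fderivWithin ℝ (f ∘ (extChartAt I b).symm) (range I) (extChartAt I b b) v := by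
  simp only [mvfderiv, mfderiv, hf]
  rfl

/-- Chain rule for vector valued functions. -/
lemma mvfderiv_vector_comp {f : B' → F} {h : B → B'} {b : B} (hf : MDiffAt f (h b))
    (hh : MDiffAt h b) (v : TangentSpace I b) :
    mvfderiv I (f ∘ h) b v = mvfderiv I' f (h b) (mfderiv I I' h b v) :=
  mfderiv_comp_apply b hf hh v

/-- Derivative of the composition of a vector valued function with a differentiable map of vector
spaces. -/
lemma mvfderiv_fderiv_comp {T : F → F'} {f : B → F} {b : B} (hT : DifferentiableAt ℝ T (f b))
    (hf : MDiffAt f b) (v : TangentSpace I b) :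
    mvfderiv I (fun q ↦ T (f q)) b v = fderiv ℝ T (f b) (mvfderiv I f b v) := by
  have := mfderiv_comp_apply b hT.mdifferentiableAt hf v
  rw [mfderiv_eq_fderiv] at this
  exact this

lemma Filter.EventuallyEq.mvfderiv_eq {f f' : B → F} {b : B} (h : f =ᶠ[𝓝 b] f') :
    mvfderiv I f b = mvfderiv I f' b := by
  ext v
  simp only [mvfderiv, ContinuousLinearMap.comp_apply, h.mfderiv_eq]
  rfl

lemma contDiffWithinAt_comp_extChartAt_symm {f : B → F} {b : B}
    (hf : ContMDiffAt I 𝓘(ℝ, F) ∞ f b) :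
    ContDiffWithinAt ℝ ∞ (f ∘ (extChartAt I b).symm) (range I) (extChartAt I b b) := by
  simpa [extChartAt_self_eq] using! (contMDiffAt_iff.1 hf).2

end VectorValuedDerivative

/-! ### The Lie bracket as a commutator of derivations. -/

section LieBracketDerivation

variable {E : Type*} [NormedAddCommGroup E] [NormedSpace ℝ E]
  {H : Type*} [TopologicalSpace H] {I : ModelWithCorners ℝ E H}
  {B : Type*} [TopologicalSpace B] [ChartedSpace H B] [IsManifold I ∞ B]
  {F : Type*} [NormedAddCommGroup F] [NormedSpace ℝ F]

/-- The derivative of `f` along a vector field, expressed in a chart. -/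
lemma fderivWithin_mpullbackWithin_eventuallyEq {f : B → F} {b : B}
    (hf : ∀ᶠ q in 𝓝 b, MDiffAt f q) (W : Π b : B, TangentSpace I b) :
    (fun z ↦ fderivWithin ℝ (f ∘ (extChartAt I b).symm) (range I) z
        (mpullbackWithin 𝓘(ℝ, E) I (extChartAt I b).symm W (range I) z))
      =ᶠ[𝓝[range I] (extChartAt I b b)]
    (fun q ↦ mvfderiv I f q (W q)) ∘ (extChartAt I b).symm := by
  have h1 : ∀ᶠ z in 𝓝[range I] (extChartAt I b b), MDiffAt f ((extChartAt I b).symm z) := by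
    have := continuousAt_extChartAt_symm (I := I) b
    rw [ContinuousAt, extChartAt_to_inv] at this
    exact (this.mono_left nhdsWithin_le_nhds).eventually hf
  filter_upwards [h1, extChartAt_target_mem_nhdsWithin b, self_mem_nhdsWithin] with z hz hzt hzr
  have hs := mdifferentiableWithinAt_extChartAt_symm (I := I) hzt
  have hc := mfderiv_comp_mfderivWithin z hz hs (I.uniqueMDiffOn z hzr)
  have hinv := isInvertible_mfderivWithin_extChartAt_symm (I := I) hzt
  rw [mfderivWithin_eq_fderivWithin] at hc
  obtain ⟨e, he⟩ := hinv
  have h3 := congrArg (fun l ↦ l (mpullbackWithin 𝓘(ℝ, E) I (extChartAt I b).symm W (range I) z)) hc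
  refine h3.trans ?_
  -- The pullback applies the inverse of the derivative of the inverse chart, which is invertible on
  -- the chart target, so pushing forward again recovers `W`.
  have h4 : mfderivWithin 𝓘(ℝ, E) I (extChartAt I b).symm (range I) z
      (mpullbackWithin 𝓘(ℝ, E) I (extChartAt I b).symm W (range I) z)
      = W ((extChartAt I b).symm z) := by
    rw [mpullbackWithin, ← he, ContinuousLinearMap.inverse_equiv]
    exact e.apply_symm_apply _
  exact congrArg (fun w ↦ mvfderiv I f ((extChartAt I b).symm z) w) h4

lemma eventually_mdiffAt_of_contMDiffAt {f : B → F} {b : B} (hf : ContMDiffAt I 𝓘(ℝ, F) ∞ f b) :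
    ∀ᶠ q in 𝓝 b, MDiffAt f q := by
  -- Regularity at a point spreads to a neighbourhood only for exponents other than `∞`, hence the
  -- drop to order one.
  have h1 : ContMDiffAt I 𝓘(ℝ, F) 1 f b := hf.of_le ENat.LEInfty.out
  filter_upwards [(contMDiffAt_iff_contMDiffAt_nhds (by simp)).1 h1] with q hq
  exact hq.mdifferentiableAt one_ne_zero

lemma differentiableWithinAt_mpullbackWithin [CompleteSpace E] {b : B}
    {W : Π b : B, TangentSpace I b}
    (hW : MDiffAt (T% W) b) :
    DifferentiableWithinAt ℝ (mpullbackWithin 𝓘(ℝ, E) I (extChartAt I b).symm W (range I))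
      (range I) (extChartAt I b b) := by
  have := (mdifferentiableWithinAt_univ.2 hW).differentiableWithinAt_mpullbackWithin_vectorField
  simpa using this

lemma mpullbackWithin_extChartAt_symm_self (b : B) (W : Π b : B, TangentSpace I b) :
    mpullbackWithin 𝓘(ℝ, E) I (extChartAt I b).symm W (range I) (extChartAt I b b) = W b := by
  -- The two values lie in different tangent spaces. Both are read in the model space `E`, where the
  -- equality makes sense.
  have key : ∀ c, c = b → (W c : E) = W b := by rintro _ rfl; rfl
  exact (congrArg (fun w : E ↦ (mfderivWithin 𝓘(ℝ, E) I (extChartAt I b).symm (range I)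
    (extChartAt I b b)).inverse w) (key _ (extChartAt_to_inv b))).trans
      (mfderivWithin_extChartAt_symm_inverse_apply (W b))

/-- The derivative of a smooth function along a differentiable vector field is differentiable. -/
lemma mdiffAt_mvfderiv_apply [CompleteSpace E] {f : B → F} {b : B} {W : Π b : B, TangentSpace I b}
    (hf : ContMDiffAt I 𝓘(ℝ, F) ∞ f b) (hW : MDiffAt (T% W) b) :
    MDiffAt (fun q ↦ mvfderiv I f q (W q)) b := by
  have h1 := fderivWithin_mpullbackWithin_eventuallyEq (eventually_mdiffAt_of_contMDiffAt hf) W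
  rw [← mdifferentiableWithinAt_univ]
  apply DifferentiableWithinAt.mdifferentiableWithinAt_of_comp_extChartAt_symm
  simp only [preimage_univ, univ_inter]
  refine DifferentiableWithinAt.congr_of_eventuallyEq ?_ h1.symm
    (h1.symm.self_of_nhdsWithin (mem_range_self _))
  have h2 := (contDiffWithinAt_comp_extChartAt_symm hf).fderivWithin_right (m := 1)
    I.uniqueDiffOn (by rw [one_add_one_eq_two]; exact ENat.LEInfty.out) (mem_range_self _)
  exact (h2.differentiableWithinAt one_ne_zero).clm_apply
    (differentiableWithinAt_mpullbackWithin hW)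

/-- The Lie bracket is the commutator of the derivations given by the vector fields. -/
lemma mvfderiv_mlieBracket [CompleteSpace E] {f : B → F} {b : B} {V W : Π b : B, TangentSpace I b}
    (hf : ContMDiffAt I 𝓘(ℝ, F) ∞ f b) (hV : MDiffAt (T% V) b) (hW : MDiffAt (T% W) b) :
    mvfderiv I f b (mlieBracket I V W b)
      = mvfderiv I (fun q ↦ mvfderiv I f q (W q)) b (V b)
        - mvfderiv I (fun q ↦ mvfderiv I f q (V q)) b (W b) := by
  have hev := eventually_mdiffAt_of_contMDiffAt hf
  have hmem : extChartAt I b b ∈ range I := mem_range_self _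
  rw [mvfderiv_eq_fderivWithin hev.self_of_nhds,
    mvfderiv_eq_fderivWithin (mdiffAt_mvfderiv_apply hf hW),
    mvfderiv_eq_fderivWithin (mdiffAt_mvfderiv_apply hf hV),
    ← (fderivWithin_mpullbackWithin_eventuallyEq hev W).fderivWithin_eq_of_mem hmem,
    ← (fderivWithin_mpullbackWithin_eventuallyEq hev V).fderivWithin_eq_of_mem hmem,
    ← mpullbackWithin_extChartAt_symm_self b V, ← mpullbackWithin_extChartAt_symm_self b W]
  -- In the chart, symmetry of the second derivative cancels the second-order terms. It holds at
  -- points of `range I` because they lie in the closure of its interior.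
  refine Eq.trans ?_ (fderivWithin_apply_lieBracket (contDiffWithinAt_comp_extChartAt_symm hf)
    (by rw [minSmoothness_of_isRCLikeNormedField]; exact ENat.LEInfty.out) I.uniqueDiffOn
    (I.range_subset_closure_interior hmem) hmem
    (differentiableWithinAt_mpullbackWithin hW) (differentiableWithinAt_mpullbackWithin hV))
  -- The derivative of a chart at its own centre is the identity, so the bracket at `b` is the
  -- bracket of the chart expressions.
  congr 1
  rw [← mlieBracketWithin_univ, mlieBracketWithin_apply, mfderiv_extChartAt_self,
    preimage_univ, univ_inter]
  exact congrArg (fun l : E →L[ℝ] E ↦ l _) ContinuousLinearMap.inverse_id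

end LieBracketDerivation

/-! ### The Koszul formula and skewness of connection coefficients. -/

section Koszul

variable {E : Type*} [NormedAddCommGroup E] [NormedSpace ℝ E] [FiniteDimensional ℝ E]
  {H : Type*} [TopologicalSpace H] {I : ModelWithCorners ℝ E H}
  {B : Type*} [TopologicalSpace B] [ChartedSpace H B] [IsManifold I ∞ B]

namespace SemiRiemannianMetric

variable (g : SemiRiemannianMetric I B) {X Y Z : Π b : B, TangentSpace I b} {b : B}

lemma leviCivita_sub_leviCivita (hX : MDiffAt (T% X) b) (hY : MDiffAt (T% Y) b) :
    g.leviCivita Y b (X b) - g.leviCivita X b (Y b) = mlieBracket I X Y b :=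
  (CovariantDerivative.torsion_eq_zero_iff _).1 g.torsion_leviCivita hX hY

/-- The Koszul formula. -/
lemma val_leviCivita (hX : MDiffAt (T% X) b) (hY : MDiffAt (T% Y) b) (hZ : MDiffAt (T% Z) b) :
    g.val b (g.leviCivita Y b (X b)) (Z b) = 1 / 2 * g.koszul X Y Z b := by
  have h1 := g.isCompatible_leviCivita b X Y Z hY hZ
  have h2 := g.isCompatible_leviCivita b Y X Z hX hZ
  have h3 := g.isCompatible_leviCivita b Z X Y hX hY
  have t1 := g.leviCivita_sub_leviCivita hX hY
  have t2 := g.leviCivita_sub_leviCivita hX hZ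
  have t3 := g.leviCivita_sub_leviCivita hY hZ
  rw [koszul, h1, h2, h3, ← t1, ← t2, ← t3]
  simp only [map_sub, sub_apply]
  rw [g.symm b (Y b), g.symm b (X b), g.symm b (X b)]
  ring

/-- Metric compatibility, with the derivative of a locally constant inner product equal to zero. For
frame fields this is the skewness of the connection coefficients. -/
lemma val_leviCivita_swap (X : Π b : B, TangentSpace I b) (hY : MDiffAt (T% Y) b)
    (hZ : MDiffAt (T% Z) b) {c : ℝ} (h : g.ip Y Z =ᶠ[𝓝 b] fun _ ↦ c) :
    g.val b (g.leviCivita Y b (X b)) (Z b) = - g.val b (g.leviCivita Z b (X b)) (Y b) := by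
  have h1 := g.isCompatible_leviCivita b X Y Z hY hZ
  rw [h.mvfderiv_eq, mvfderiv_const] at h1
  rw [g.symm b _ (Y b), eq_neg_iff_add_eq_zero, ← h1]
  rfl

end SemiRiemannianMetric
end Koszul

/-! ### Derivatives and Lie brackets on a product manifold. -/

section ProductBracket

variable {EM : Type*} [NormedAddCommGroup EM] [NormedSpace ℝ EM]
  {HM : Type*} [TopologicalSpace HM] {IM : ModelWithCorners ℝ EM HM}
  {M : Type*} [TopologicalSpace M] [ChartedSpace HM M]
  {EK : Type*} [NormedAddCommGroup EK] [NormedSpace ℝ EK]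
  {HK : Type*} [TopologicalSpace HK] {IK : ModelWithCorners ℝ EK HK}
  {K : Type*} [TopologicalSpace K] [ChartedSpace HK K]
  {F : Type*} [NormedAddCommGroup F] [NormedSpace ℝ F]

/-- The derivative of a function of two variables in terms of its partial derivatives. -/
lemma mvfderiv_prod_apply {f : M × K → F} {p : M × K}
    (hf : MDifferentiableAt (IM.prod IK) 𝓘(ℝ, F) f p) (v : EM × EK) :
    mvfderiv (IM.prod IK) f p v
      = mvfderiv IM (fun x ↦ f (x, p.2)) p.1 v.1 + mvfderiv IK (fun y ↦ f (p.1, y)) p.2 v.2 :=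
  mfderiv_prod_eq_add_apply hf

lemma mvfderiv_comp_fst {f : M → F} {p : M × K} (hf : MDifferentiableAt IM 𝓘(ℝ, F) f p.1)
    (v : EM × EK) :
    mvfderiv (IM.prod IK) (fun q : M × K ↦ f q.1) p v = mvfderiv IM f p.1 v.1 := by
  have := mvfderiv_vector_comp (h := Prod.fst) hf (mdifferentiableAt_fst (I := IM) (I' := IK)) v
  rw [mfderiv_fst] at this
  exact this

lemma mvfderiv_comp_snd {f : K → F} {p : M × K} (hf : MDifferentiableAt IK 𝓘(ℝ, F) f p.2)
    (v : EM × EK) :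
    mvfderiv (IM.prod IK) (fun q : M × K ↦ f q.2) p v = mvfderiv IK f p.2 v.2 := by
  have := mvfderiv_vector_comp (h := Prod.snd) hf (mdifferentiableAt_snd (I := IM) (I' := IK)) v
  rw [mfderiv_snd] at this
  exact this

/-- The chart of one factor serves as a vector-valued test function on the product: at its centre,
its derivative along a tangent vector is the component of that vector along the factor. -/
lemma contMDiffAt_extChartAt_comp_snd (p : M × K) :
    ContMDiffAt (IM.prod IK) 𝓘(ℝ, EK) ∞ (fun q : M × K ↦ extChartAt IK p.2 q.2) p :=
  (contMDiffAt_extChartAt (I := IK) (n := ∞) (x := p.2)).comp p contMDiffAt_snd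

lemma contMDiffAt_extChartAt_comp_fst (p : M × K) :
    ContMDiffAt (IM.prod IK) 𝓘(ℝ, EM) ∞ (fun q : M × K ↦ extChartAt IM p.1 q.1) p :=
  (contMDiffAt_extChartAt (I := IM) (n := ∞) (x := p.1)).comp p contMDiffAt_fst

lemma mvfderiv_extChartAt_comp_snd_eventuallyEq [IsManifold IK ∞ K] (p : M × K)
    (W : Π p : M × K, TangentSpace (IM.prod IK) p) :
    (fun q ↦ mvfderiv (IM.prod IK) (fun q : M × K ↦ extChartAt IK p.2 q.2) q (W q))
      =ᶠ[𝓝 p] fun q ↦ mvfderiv IK (extChartAt IK p.2) q.2 (restrictFibre W q.1 q.2) := by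
  have h := eventually_mdiffAt_of_contMDiffAt (contMDiffAt_extChartAt (I := IK) (n := ∞) (x := p.2))
  filter_upwards [continuousAt_snd.eventually h] with q hq
  exact mvfderiv_comp_snd hq (W q)

variable [IsManifold IM ∞ M] [IsManifold IK ∞ K]

lemma mvfderiv_extChartAt_self {E : Type*} [NormedAddCommGroup E] [NormedSpace ℝ E]
    {H : Type*} [TopologicalSpace H] {I : ModelWithCorners ℝ E H}
    {B : Type*} [TopologicalSpace B] [ChartedSpace H B] [IsManifold I ∞ B] (b : B) (v : E) :
    mvfderiv I (extChartAt I b) b v = v :=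
  congrArg (fun l : E →L[ℝ] E ↦ l v) (mfderiv_extChartAt_self (I := I) (x := b))

lemma mdiffAt_liftBase {X : Π x : M, TangentSpace IM x} {p : M × K} (hX : MDiffAt (T% X) p.1) :
    MDifferentiableAt (IM.prod IK) (IM.prod IK).tangent
      (fun q ↦ (⟨q, liftBase X q⟩ : TangentBundle (IM.prod IK) (M × K))) p := by
  have h1 : MDifferentiableAt (IM.prod IK) IM.tangent
      (fun q : M × K ↦ (⟨q.1, X q.1⟩ : TangentBundle IM M)) p :=
    hX.comp p mdifferentiableAt_fst
  have h2 : MDifferentiableAt (IM.prod IK) IK.tangent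
      (fun q : M × K ↦ (⟨q.2, 0⟩ : TangentBundle IK K)) p :=
    (((contMDiff_zeroSection ℝ (TangentSpace IK : K → Type _)).mdifferentiable
      (n := 1) one_ne_zero) p.2).comp p mdifferentiableAt_snd
  exact ((contMDiff_equivTangentBundleProd_symm (n := 1)).mdifferentiable one_ne_zero _).comp p
    (h1.prodMk h2)

/-- The restricted field is the tangent map of the second projection composed with `W` along the
slice through `p`. -/
lemma mdiffAt_restrictFibre {W : Π p : M × K, TangentSpace (IM.prod IK) p} {p : M × K}
    (hW : MDiffAt (T% W) p) : MDiffAt (T% (restrictFibre W p.1)) p.2 := by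
  have h1 : MDifferentiableAt IK (IM.prod IK).tangent
      (fun y ↦ (⟨(p.1, y), W (p.1, y)⟩ : TangentBundle (IM.prod IK) (M × K))) p.2 :=
    MDifferentiableAt.comp p.2 (g := T% W) (f := fun y ↦ (p.1, y)) hW
      (mdifferentiableAt_const.prodMk mdifferentiableAt_id)
  have h2 : ContMDiff (IM.prod IK).tangent IK.tangent 1
      (tangentMap (IM.prod IK) IK (Prod.snd : M × K → K)) :=
    (contMDiff_snd (n := 2)).contMDiff_tangentMap (by norm_num)
  have h3 := (h2.mdifferentiable one_ne_zero _).comp p.2 h1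
  convert h3 using 2 with y
  simp only [Function.comp, tangentMap_prodSnd]
  rfl

section

variable [CompleteSpace EM] [CompleteSpace EK]
  {V W : Π p : M × K, TangentSpace (IM.prod IK) p} {p : M × K}

/-- The derivative at fixed `p.2` of the component along `K` of a vector field on `M × K`. -/
noncomputable def partialDeriv (W : Π p : M × K, TangentSpace (IM.prod IK) p) (p : M × K)
    (v : TangentSpace IM p.1) : TangentSpace IK p.2 :=
  mvfderiv (F := EK) IM (fun x ↦ restrictFibre W x p.2) p.1 v

/-- Along `M` the point of `K` stays at the centre of the chart, where the chart derivative is the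
identity, so an ordinary derivative in one fixed tangent space remains. Along `K` the term is the
one occurring in the bracket on the fibre. -/
lemma mvfderiv_mvfderiv_extChartAt_comp_snd (hW : MDiffAt (T% W) p) (v : EM × EK) :
    mvfderiv (IM.prod IK) (fun q ↦ mvfderiv (IM.prod IK)
        (fun q : M × K ↦ extChartAt IK p.2 q.2) q (W q)) p v
      = mvfderiv (F := EK) IM (fun x ↦ restrictFibre W x p.2) p.1 v.1
        + mvfderiv IK (fun y ↦ mvfderiv IK (extChartAt IK p.2) y (restrictFibre W p.1 y)) p.2
          v.2 := by
  have h1 := mdiffAt_mvfderiv_apply (contMDiffAt_extChartAt_comp_snd p) hW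
  have h2 := mvfderiv_extChartAt_comp_snd_eventuallyEq p W
  rw [h2.mvfderiv_eq, mvfderiv_prod_apply (h1.congr_of_eventuallyEq h2.symm)]
  have h3 : (fun x ↦ mvfderiv IK (extChartAt IK p.2) p.2 (restrictFibre W x p.2))
      = fun x ↦ (restrictFibre W x p.2 : EK) := funext fun x ↦ mvfderiv_extChartAt_self p.2 _
  exact congrArg (fun f : M → EK ↦ mvfderiv IM f p.1 v.1
    + mvfderiv IK (fun y ↦ mvfderiv IK (extChartAt IK p.2) y (restrictFibre W p.1 y)) p.2 v.2) h3

/-- The component along `K` of a Lie bracket of vector fields on `M × K`. -/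
lemma mlieBracket_prod_snd (hV : MDiffAt (T% V) p) (hW : MDiffAt (T% W) p) :
    restrictFibre (mlieBracket (IM.prod IK) V W) p.1 p.2
      = partialDeriv W p (V p : EM × EK).1 - partialDeriv V p (W p : EM × EK).1
        + mlieBracket IK (restrictFibre V p.1) (restrictFibre W p.1) p.2 := by
  have h1 := mvfderiv_mlieBracket (contMDiffAt_extChartAt_comp_snd p) hV hW
  have h2 := mvfderiv_mlieBracket (contMDiffAt_extChartAt (I := IK) (n := ∞) (x := p.2))
    (mdiffAt_restrictFibre hV) (mdiffAt_restrictFibre hW)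
  have h3 := (mvfderiv_comp_snd (IM := IM) (mdifferentiableAt_extChartAt (mem_chart_source HK p.2))
    (mlieBracket (IM.prod IK) V W p)).trans (mvfderiv_extChartAt_self (I := IK) p.2 _)
  have h4 := (mvfderiv_extChartAt_self (I := IK) p.2 _).symm.trans h2
  have h5 := congrArg₂ (fun a b : EK ↦ a - b)
    (mvfderiv_mvfderiv_extChartAt_comp_snd hW (V p))
    (mvfderiv_mvfderiv_extChartAt_comp_snd hV (W p))
  refine ((h3.symm.trans h1).trans h5).trans (Eq.trans ?_ (congrArg (fun w : TangentSpace IK p.2 ↦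
    partialDeriv W p (V p : EM × EK).1 - partialDeriv V p (W p : EM × EK).1 + w) h4.symm))
  exact add_sub_add_comm _ _ _ _

/-- The component along `M` of a Lie bracket of projectable vector fields on `M × K`. -/
lemma mlieBracket_prod_fst {V₀ W₀ : Π x : M, TangentSpace IM x}
    (hV : MDiffAt (T% V) p) (hW : MDiffAt (T% W) p)
    (hV₀ : MDiffAt (T% V₀) p.1) (hW₀ : MDiffAt (T% W₀) p.1)
    (h : ∀ᶠ q in 𝓝 p, (V q : EM × EK).1 = V₀ q.1) (h' : ∀ᶠ q in 𝓝 p, (W q : EM × EK).1 = W₀ q.1) :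
    (mlieBracket (IM.prod IK) V W p : EM × EK).1 = mlieBracket IM V₀ W₀ p.1 := by
  have hchart := contMDiffAt_extChartAt (I := IM) (n := ∞) (x := p.1)
  -- Projectability makes the first derivative of the base chart a function pulled back from `M`, so
  -- the second derivative sees only the base component of `v`.
  have key : ∀ {X : Π p : M × K, TangentSpace (IM.prod IK) p} {X₀ : Π x : M, TangentSpace IM x},
      MDiffAt (T% X₀) p.1 → (∀ᶠ q in 𝓝 p, (X q : EM × EK).1 = X₀ q.1) → ∀ v : EM × EK,
      mvfderiv (IM.prod IK) (fun q ↦ mvfderiv (IM.prod IK)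
        (fun q : M × K ↦ extChartAt IM p.1 q.1) q (X q)) p v
      = mvfderiv IM (fun x ↦ mvfderiv IM (extChartAt IM p.1) x (X₀ x)) p.1 v.1 := by
    intro X X₀ hX₀ hX v
    rw [← mvfderiv_comp_fst (IK := IK) (mdiffAt_mvfderiv_apply hchart hX₀)]
    refine congrArg (fun l : EM × EK →L[ℝ] EM ↦ l v) (EventuallyEq.mvfderiv_eq ?_)
    filter_upwards [continuousAt_fst.eventually (eventually_mdiffAt_of_contMDiffAt hchart), hX]
      with q hq hXq
    refine (mvfderiv_comp_fst hq (X q)).trans ?_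
    rw [hXq]
  have h1 := mvfderiv_mlieBracket (contMDiffAt_extChartAt_comp_fst p) hV hW
  have h2 := mvfderiv_mlieBracket hchart hV₀ hW₀
  have h3 := (mvfderiv_comp_fst (IK := IK) (mdifferentiableAt_extChartAt (mem_chart_source HM p.1))
    (mlieBracket (IM.prod IK) V W p)).trans (mvfderiv_extChartAt_self (I := IM) p.1 _)
  have h4 := (mvfderiv_extChartAt_self (I := IM) p.1 _).symm.trans h2
  have h5 := congrArg₂ (fun a b : EM ↦ a - b) (key hW₀ h' (V p)) (key hV₀ h (W p))
  rw [h.self_of_nhds, h'.self_of_nhds] at h5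
  exact ((h3.symm.trans h1).trans h5).trans h4.symm

end

end ProductBracket

/-! ### The submersive metric and brackets of horizontal and vertical fields. -/

/-- A symmetric bilinear form on a product, given by its values on the two factors. -/
lemma submersiveForm_apply {EM EK : Type*} [NormedAddCommGroup EM] [NormedSpace ℝ EM]
    [NormedAddCommGroup EK] [NormedSpace ℝ EK]
    {gP : EM × EK →L[ℝ] EM × EK →L[ℝ] ℝ}
    {gK : EK →L[ℝ] EK →L[ℝ] ℝ} {gM : EM →L[ℝ] EM →L[ℝ] ℝ} {A : EM →L[ℝ] EK}
    (symm : ∀ a b, gP a b = gP b a)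
    (vertical : ∀ u v, gP (0, u) (0, v) = gK u v) (mixed : ∀ w v, gP (w, 0) (0, v) = -gK (A w) v)
    (base : ∀ w z, gP (w, 0) (z, 0) = gM w z + gK (A w) (A z)) (a b : EM × EK) :
    gP a b = gM a.1 b.1 + gK (a.2 - A a.1) (b.2 - A b.1) := by
  have ha : gP a b = gP ((a.1, 0) + (0, a.2)) ((b.1, 0) + (0, b.2)) := by simp
  have hK : ∀ u v, gK u v = gK v u := fun u v ↦ by rw [← vertical, symm, vertical]
  rw [ha]
  simp only [map_add, add_apply, base, mixed, vertical, symm (0, a.2) (b.1, 0), map_sub, sub_apply,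
    hK (A b.1) a.2]
  ring

namespace SubmersiveMetric

variable {EM : Type*} [NormedAddCommGroup EM] [NormedSpace ℝ EM]
  {HM : Type*} [TopologicalSpace HM] {IM : ModelWithCorners ℝ EM HM}
  {M : Type*} [TopologicalSpace M] [ChartedSpace HM M] [IsManifold IM ∞ M]
  {EK : Type*} [NormedAddCommGroup EK] [NormedSpace ℝ EK]
  {HK : Type*} [TopologicalSpace HK] {IK : ModelWithCorners ℝ EK HK}
  {K : Type*} [TopologicalSpace K] [ChartedSpace HK K] [IsManifold IK ∞ K]
  (G : SubmersiveMetric IM M IK K)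
  {X Y Z : Π x : M, TangentSpace IM x}
  {U V W : Π p : M × K, TangentSpace (IM.prod IK) p} {p : M × K}

/-- The metric on the total space, evaluated on an arbitrary vector and a vertical one. -/
lemma gP_apply_of_fst_eq_zero (a b : EM × EK) (hb : b.1 = 0) :
    G.gP.val p a b = (G.gK p.1).val p.2 a.2 b.2 - (G.gK p.1).val p.2 (G.A p a.1) b.2 := by
  have key : ∀ (gM : EM →L[ℝ] EM →L[ℝ] ℝ) (gK : EK →L[ℝ] EK →L[ℝ] ℝ) (A : EM →L[ℝ] EK),
      gM a.1 b.1 + gK (a.2 - A a.1) (b.2 - A b.1) = gK a.2 b.2 - gK (A a.1) b.2 := by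
    intro gM gK A
    simp [hb]
  exact (submersiveForm_apply (gP := G.gP.val p) (gM := G.gM.val p.1)
    (gK := (G.gK p.1).val p.2) (A := G.A p) (G.gP.symm p) (G.gP_vertical p) (G.gP_mixed p)
    (G.gP_base p) a b).trans
    (key (G.gM.val p.1) ((G.gK p.1).val p.2) (G.A p))

/-- The metric on the total space, evaluated on an arbitrary vector and a horizontal one. -/
lemma gP_apply_horizontalLift (a : EM × EK) :
    G.gP.val p a (G.horizontalLift X p) = G.gM.val p.1 a.1 (X p.1) := by
  have key : ∀ (gM : EM →L[ℝ] EM →L[ℝ] ℝ) (gK : EK →L[ℝ] EK →L[ℝ] ℝ) (A : EM →L[ℝ] EK) (w : EM),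
      gM a.1 w + gK (a.2 - A a.1) (A w - A w) = gM a.1 w := by
    intro gM gK A
    simp
  exact (submersiveForm_apply (gP := G.gP.val p) (gM := G.gM.val p.1)
    (gK := (G.gK p.1).val p.2) (A := G.A p) (G.gP.symm p) (G.gP_vertical p) (G.gP_mixed p)
    (G.gP_base p) a (G.horizontalLift X p)).trans
    (key (G.gM.val p.1) ((G.gK p.1).val p.2) (G.A p) (X p.1))

lemma gP_horizontalLift_eq_zero {a : TangentSpace (IM.prod IK) p} (ha : (a : EM × EK).1 = 0) :
    G.gP.val p a (G.horizontalLift X p) = 0 := by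
  refine (G.gP_apply_horizontalLift a).trans ?_
  rw [ha]
  exact congrArg (fun l : EM →L[ℝ] ℝ ↦ l (X p.1)) (map_zero (G.gM.val p.1))

/-- The lift is `X` plus its image under the bundle endomorphism `(w, u) ↦ (0, A w)`, whose
smoothness is the content of `contMDiff_A`. -/
lemma mdiffAt_horizontalLift (hX : MDiffAt (T% X) p.1) :
    MDiffAt (T% (G.horizontalLift X)) p := by
  have h1 := mdiffAt_liftBase (IK := IK) hX
  have h2 : MDifferentiableAt (IM.prod IK) (IM.prod IK).tangent
      (fun q ↦ (⟨q, ((0, G.A q (X q.1)) : EM × EK)⟩ : TangentBundle (IM.prod IK) (M × K))) p := by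
    have h3 := G.contMDiff_A.mdifferentiableAt (x := p) (by simp)
    exact MDifferentiableAt.clm_bundle_apply (F₁ := EM × EK) (F₂ := EM × EK)
      (E₁ := fun p : M × K ↦ TangentSpace (IM.prod IK) p)
      (E₂ := fun p : M × K ↦ TangentSpace (IM.prod IK) p) (b := id) h3 h1
  have h3 := mdifferentiableAt_add_section h1 h2
  convert h3 using 3 with q
  exact Prod.ext (add_zero _).symm (zero_add _).symm

lemma gP_apply_vertical (Z : Π p : M × K, TangentSpace (IM.prod IK) p)
    (hZ : (Z p : EM × EK).1 = 0) (hV : (V p : EM × EK).1 = 0) :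
    G.gP.val p (Z p) (V p)
      = (G.gK p.1).val p.2 (restrictFibre Z p.1 p.2) (restrictFibre V p.1 p.2) := by
  have h1 := G.gP_apply_of_fst_eq_zero (p := p) (Z p) (V p) hV
  have h2 : G.A p (Z p : EM × EK).1 = 0 := (congrArg (G.A p) hZ).trans (map_zero _)
  rw [h2, map_zero] at h1
  exact h1.trans (sub_zero _)

lemma ip_horizontalLift :
    G.gP.ip (G.horizontalLift X) (G.horizontalLift Y) = fun q ↦ G.gM.ip X Y q.1 :=
  funext fun q ↦ G.gP_apply_horizontalLift (G.horizontalLift X q)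

lemma ip_vertical_horizontalLift (hV : ∀ᶠ q in 𝓝 p, (V q : EM × EK).1 = 0) :
    G.gP.ip V (G.horizontalLift X) =ᶠ[𝓝 p] fun _ ↦ 0 := by
  filter_upwards [hV] with q hq
  refine (G.gP_apply_horizontalLift (V q)).trans ?_
  rw [hq]
  exact congrArg (fun l : EM →L[ℝ] ℝ ↦ l (X q.1)) (map_zero (G.gM.val q.1))

lemma ip_horizontalLift_vertical (hV : ∀ᶠ q in 𝓝 p, (V q : EM × EK).1 = 0) :
    G.gP.ip (G.horizontalLift X) V =ᶠ[𝓝 p] fun _ ↦ 0 := by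
  rw [G.gP.ip_comm]
  exact G.ip_vertical_horizontalLift hV

lemma ip_vertical (hU : ∀ᶠ q in 𝓝 p, (U q : EM × EK).1 = 0)
    (hV : ∀ᶠ q in 𝓝 p, (V q : EM × EK).1 = 0) :
    G.gP.ip U V
      =ᶠ[𝓝 p] fun q ↦ (G.gK q.1).ip (restrictFibre U q.1) (restrictFibre V q.1) q.2 := by
  filter_upwards [hU, hV] with q hq hq'
  exact G.gP_apply_vertical U hq hq'

lemma mvfderiv_ip_horizontalLift (hX : MDiffAt (T% X) p.1) (hY : MDiffAt (T% Y) p.1)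
    (v : EM × EK) :
    mvfderiv (IM.prod IK) (G.gP.ip (G.horizontalLift X) (G.horizontalLift Y)) p v
      = mvfderiv IM (G.gM.ip X Y) p.1 v.1 := by
  rw [ip_horizontalLift]
  exact mvfderiv_comp_fst (G.gM.mdiffAt_ip hX hY) v

/-- Separates the variation of the fibre metric with the base point from the variation inside one
fibre. For a lift, the two parts supply the derivative terms of the two Lie derivatives in
`covDerivMetric`. -/
lemma mvfderiv_ip_vertical (hU : MDiffAt (T% U) p) (hV : MDiffAt (T% V) p)
    (hU' : ∀ᶠ q in 𝓝 p, (U q : EM × EK).1 = 0) (hV' : ∀ᶠ q in 𝓝 p, (V q : EM × EK).1 = 0)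
    (v : EM × EK) :
    mvfderiv (IM.prod IK) (G.gP.ip U V) p v
      = mvfderiv (IM.prod IK)
          (fun q ↦ (G.gK q.1).ip (restrictFibre U q.1) (restrictFibre V q.1) q.2) p
          ((v.1, 0) : EM × EK)
        + mvfderiv IK ((G.gK p.1).ip (restrictFibre U p.1) (restrictFibre V p.1)) p.2 v.2 := by
  have h := G.ip_vertical hU' hV'
  have hd := (G.gP.mdiffAt_ip hU hV).congr_of_eventuallyEq h.symm
  rw [h.mvfderiv_eq, mvfderiv_prod_apply hd v, mvfderiv_prod_apply hd (v.1, 0)]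
  have h0 := map_zero (mvfderiv IK
    (fun y ↦ (G.gK p.1).ip (restrictFibre U p.1) (restrictFibre V p.1) y) p.2)
  have h1 : ∀ a b c : ℝ, c = 0 → a + b = a + c + b := by rintro a b _ rfl; ring
  exact h1 _ _ _ h0

variable [CompleteSpace EM] [CompleteSpace EK]

/-- Vertical fields are projectable onto the zero field, and the bracket projects to the bracket of
the projections. -/
lemma mlieBracket_vertical_fst (hU : MDiffAt (T% U) p) (hV : MDiffAt (T% V) p)
    (hU' : ∀ᶠ q in 𝓝 p, (U q : EM × EK).1 = 0) (hV' : ∀ᶠ q in 𝓝 p, (V q : EM × EK).1 = 0) :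
    (mlieBracket (IM.prod IK) U V p : EM × EK).1 = 0 := by
  have hz : MDiffAt (T% (0 : Π x : M, TangentSpace IM x)) p.1 :=
    ((contMDiff_zeroSection ℝ (TangentSpace IM : M → Type _)).mdifferentiable
      (n := 1) one_ne_zero) p.1
  refine (mlieBracket_prod_fst hU hV hz hz hU' hV').trans ?_
  rw [mlieBracket_zero_left]
  rfl

lemma mlieBracket_projectable_vertical_fst (hU : MDiffAt (T% U) p) (hV : MDiffAt (T% V) p)
    (hX : MDiffAt (T% X) p.1) (hU' : ∀ q, (U q : EM × EK).1 = X q.1)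
    (hV' : ∀ᶠ q in 𝓝 p, (V q : EM × EK).1 = 0) :
    (mlieBracket (IM.prod IK) U V p : EM × EK).1 = 0 := by
  have hz : MDiffAt (T% (0 : Π x : M, TangentSpace IM x)) p.1 :=
    ((contMDiff_zeroSection ℝ (TangentSpace IM : M → Type _)).mdifferentiable
      (n := 1) one_ne_zero) p.1
  refine (mlieBracket_prod_fst hU hV hX hz (.of_forall hU') hV').trans ?_
  rw [mlieBracket_zero_right]
  rfl

/-- The Lie bracket of vertical vector fields is computed on the fibre. -/
lemma mlieBracket_vertical_snd (hU : MDiffAt (T% U) p) (hV : MDiffAt (T% V) p)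
    (hU' : (U p : EM × EK).1 = 0) (hV' : (V p : EM × EK).1 = 0) :
    restrictFibre (mlieBracket (IM.prod IK) U V) p.1 p.2
      = mlieBracket IK (restrictFibre U p.1) (restrictFibre V p.1) p.2 := by
  rw [mlieBracket_prod_snd hU hV, hU', hV']
  have h : ∀ W : Π p : M × K, TangentSpace (IM.prod IK) p, partialDeriv W p 0 = 0 :=
    fun W ↦ map_zero (mvfderiv (F := EK) IM (fun x ↦ restrictFibre W x p.2) p.1)
  erw [h, h]
  rw [sub_zero, zero_add]

/-- The Lie bracket of a basic horizontal vector field with a vertical one. -/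
lemma mlieBracket_horizontalLift_vertical_snd (hX : MDiffAt (T% X) p.1) (hV : MDiffAt (T% V) p)
    (hV' : (V p : EM × EK).1 = 0) :
    restrictFibre (mlieBracket (IM.prod IK) (G.horizontalLift X) V) p.1 p.2
      = restrictFibre (mlieBracket (IM.prod IK) (liftBase X) V) p.1 p.2
        + mlieBracket IK (G.gauge X p.1) (restrictFibre V p.1) p.2 := by
  have h : ∀ W : Π p : M × K, TangentSpace (IM.prod IK) p, partialDeriv W p 0 = 0 :=
    fun W ↦ map_zero (mvfderiv (F := EK) IM (fun x ↦ restrictFibre W x p.2) p.1)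
  rw [mlieBracket_prod_snd (G.mdiffAt_horizontalLift hX) hV,
    mlieBracket_prod_snd (mdiffAt_liftBase hX) hV, hV']
  -- `X` and `X^H` have the same base component, hence the same derivative of `V` along `M`. They
  -- differ only in the fibre bracket, which vanishes for `X`.
  have h0 : restrictFibre (liftBase (IM := IM) (IK := IK) (K := K) X) p.1 = 0 := rfl
  erw [h, h]
  rw [h0, mlieBracket_zero_left, sub_zero, sub_zero, Pi.zero_apply, add_zero]
  rfl

/-- The curvature is the vertical part of the Lie bracket of basic horizontal vector fields. -/
lemma mlieBracket_horizontalLift_snd (hX : MDiffAt (T% X) p.1) (hY : MDiffAt (T% Y) p.1) :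
    restrictFibre (mlieBracket (IM.prod IK) (G.horizontalLift X) (G.horizontalLift Y)) p.1 p.2
      = G.curvature X Y p + G.A p (mlieBracket IM X Y p.1) := by
  rw [mlieBracket_prod_snd (G.mdiffAt_horizontalLift hX) (G.mdiffAt_horizontalLift hY), curvature]
  change G.derivGauge X Y p - G.derivGauge Y X p
    + mlieBracket IK (G.gauge X p.1) (G.gauge Y p.1) p.2 = _
  abel

lemma mlieBracket_horizontalLift_fst (hX : MDiffAt (T% X) p.1) (hY : MDiffAt (T% Y) p.1) :
    (mlieBracket (IM.prod IK) (G.horizontalLift X) (G.horizontalLift Y) p : EM × EK).1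
      = mlieBracket IM X Y p.1 :=
  mlieBracket_prod_fst (G.mdiffAt_horizontalLift hX) (G.mdiffAt_horizontalLift hY) hX hY
    (.of_forall fun _ ↦ rfl) (.of_forall fun _ ↦ rfl)

/-- The inner product of a vertical vector with a Lie bracket of basic horizontal fields. -/
lemma gP_mlieBracket_horizontalLift (hX : MDiffAt (T% X) p.1) (hY : MDiffAt (T% Y) p.1)
    (hV : (V p : EM × EK).1 = 0) :
    G.gP.val p (mlieBracket (IM.prod IK) (G.horizontalLift X) (G.horizontalLift Y) p) (V p)
      = (G.gK p.1).val p.2 (G.curvature X Y p) (restrictFibre V p.1 p.2) := by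
  -- Pairing with a vertical vector subtracts `A` of the base component, which removes the `A([X,
  -- Y])` contained in the `K`-component of the bracket.
  refine (G.gP_apply_of_fst_eq_zero _ (V p) hV).trans ?_
  rw [G.mlieBracket_horizontalLift_fst hX hY]
  have h := congrArg (fun w ↦ (G.gK p.1).val p.2 w (restrictFibre V p.1 p.2))
    (G.mlieBracket_horizontalLift_snd hX hY)
  simp only [map_add, add_apply] at h
  exact sub_eq_of_eq_add h

end SubmersiveMetric

/-! ### Levi-Civita coefficients of the total space. -/

namespace SubmersiveMetric

variable {EM : Type*} [NormedAddCommGroup EM] [NormedSpace ℝ EM] [FiniteDimensional ℝ EM]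
  {HM : Type*} [TopologicalSpace HM] {IM : ModelWithCorners ℝ EM HM}
  {M : Type*} [TopologicalSpace M] [ChartedSpace HM M] [IsManifold IM ∞ M]
  {EK : Type*} [NormedAddCommGroup EK] [NormedSpace ℝ EK] [FiniteDimensional ℝ EK]
  {HK : Type*} [TopologicalSpace HK] {IK : ModelWithCorners ℝ EK HK}
  {K : Type*} [TopologicalSpace K] [ChartedSpace HK K] [IsManifold IK ∞ K]
  (G : SubmersiveMetric IM M IK K)
  {X Y Z : Π x : M, TangentSpace IM x}
  {U V W : Π p : M × K, TangentSpace (IM.prod IK) p} {p : M × K}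

/-- On the fibres, the Levi-Civita connection of the total space is that of the fibre metric. -/
lemma gP_leviCivita_vertical_vertical_vertical
    (hU : MDiffAt (T% U) p) (hV : MDiffAt (T% V) p) (hW : MDiffAt (T% W) p)
    (hU' : ∀ᶠ q in 𝓝 p, (U q : EM × EK).1 = 0) (hV' : ∀ᶠ q in 𝓝 p, (V q : EM × EK).1 = 0)
    (hW' : ∀ᶠ q in 𝓝 p, (W q : EM × EK).1 = 0) :
    G.gP.val p (G.gP.leviCivita V p (U p)) (W p)
      = (G.gK p.1).val p.2 ((G.gK p.1).leviCivita (restrictFibre V p.1) p.2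
          (restrictFibre U p.1 p.2)) (restrictFibre W p.1 p.2) := by
  have := FiniteDimensional.complete ℝ EM
  have := FiniteDimensional.complete ℝ EK
  rw [G.gP.val_leviCivita hU hV hW, (G.gK p.1).val_leviCivita (mdiffAt_restrictFibre hU)
    (mdiffAt_restrictFibre hV) (mdiffAt_restrictFibre hW)]
  have hd : ∀ {A B C : Π p : M × K, TangentSpace (IM.prod IK) p}, MDiffAt (T% A) p →
      MDiffAt (T% B) p → (∀ᶠ q in 𝓝 p, (A q : EM × EK).1 = 0) →
      (∀ᶠ q in 𝓝 p, (B q : EM × EK).1 = 0) → (∀ᶠ q in 𝓝 p, (C q : EM × EK).1 = 0) →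
      mvfderiv (IM.prod IK) (G.gP.ip A B) p (C p)
        = mvfderiv IK ((G.gK p.1).ip (restrictFibre A p.1) (restrictFibre B p.1)) p.2
          (restrictFibre C p.1 p.2) := by
    intro A B C hA hB hA' hB' hC'
    refine (G.mvfderiv_ip_vertical hA hB hA' hB' (C p)).trans ?_
    rw [hC'.self_of_nhds]
    exact add_eq_right.2 (map_zero _)
  have hb : ∀ {A B C : Π p : M × K, TangentSpace (IM.prod IK) p}, MDiffAt (T% A) p →
      MDiffAt (T% B) p → (∀ᶠ q in 𝓝 p, (A q : EM × EK).1 = 0) →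
      (∀ᶠ q in 𝓝 p, (B q : EM × EK).1 = 0) → (∀ᶠ q in 𝓝 p, (C q : EM × EK).1 = 0) →
      G.gP.val p (mlieBracket (IM.prod IK) A B p) (C p)
        = (G.gK p.1).val p.2 (mlieBracket IK (restrictFibre A p.1) (restrictFibre B p.1) p.2)
          (restrictFibre C p.1 p.2) := by
    intro A B C hA hB hA' hB' hC'
    rw [G.gP_apply_vertical (mlieBracket (IM.prod IK) A B)
      (mlieBracket_vertical_fst hA hB hA' hB') hC'.self_of_nhds,
      mlieBracket_vertical_snd hA hB hA'.self_of_nhds hB'.self_of_nhds]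
  rw [SemiRiemannianMetric.koszul, SemiRiemannianMetric.koszul, hd hV hW hV' hW' hU',
    hd hU hW hU' hW' hV', hd hU hV hU' hV' hW', hb hU hV hU' hV' hW', hb hU hW hU' hW' hV',
    hb hV hW hV' hW' hU']

/-- The inner product of two lifts is constant along fibres, `U` is orthogonal to lifts, and its
brackets with lifts are vertical. Only `-gP([X^H, Y^H], U)` survives in the Koszul expression. -/
lemma gP_leviCivita_vertical_horizontal_horizontal
    (hU : MDiffAt (T% U) p) (hU' : ∀ᶠ q in 𝓝 p, (U q : EM × EK).1 = 0)
    (hX : MDiffAt (T% X) p.1) (hY : MDiffAt (T% Y) p.1) :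
    G.gP.val p (G.gP.leviCivita (G.horizontalLift X) p (U p)) (G.horizontalLift Y p)
      = -(1 / 2) * (G.gK p.1).val p.2 (G.curvature X Y p) (restrictFibre U p.1 p.2) := by
  have := FiniteDimensional.complete ℝ EM
  have := FiniteDimensional.complete ℝ EK
  have hX' := G.mdiffAt_horizontalLift hX
  have hY' := G.mdiffAt_horizontalLift hY
  have h0 : mvfderiv (IM.prod IK) (G.gP.ip (G.horizontalLift X) (G.horizontalLift Y)) p (U p)
      = 0 := by
    refine (G.mvfderiv_ip_horizontalLift hX hY (U p)).trans ?_
    rw [hU'.self_of_nhds]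
    exact map_zero (mvfderiv IM (G.gM.ip X Y) p.1)
  have hb : ∀ {X Y : Π x : M, TangentSpace IM x}, MDiffAt (T% X) p.1 →
      G.gP.val p (mlieBracket (IM.prod IK) U (G.horizontalLift X) p) (G.horizontalLift Y p)
      = 0 := by
    intro X Y hX
    rw [mlieBracket_swap_apply, map_neg, neg_apply, G.gP_horizontalLift_eq_zero
      (mlieBracket_projectable_vertical_fst (G.mdiffAt_horizontalLift hX) hU hX (fun _ ↦ rfl) hU'),
      neg_zero]
  rw [G.gP.val_leviCivita hU hX' hY', SemiRiemannianMetric.koszul, h0,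
    (G.ip_vertical_horizontalLift hU').mvfderiv_eq, (G.ip_vertical_horizontalLift hU').mvfderiv_eq,
    hb hX, hb hY, G.gP_mlieBracket_horizontalLift hX hY hU'.self_of_nhds, mvfderiv_const]
  simp only [zero_apply]
  ring

/-- The surviving Koszul terms are the Lie derivative of `gP` along `X^H` on vertical fields. Since
`X^H = X + A(X)`, it splits into the two parts of `d^A gK`. -/
lemma gP_leviCivita_vertical_horizontal_vertical
    (hU : MDiffAt (T% U) p) (hU' : ∀ᶠ q in 𝓝 p, (U q : EM × EK).1 = 0)
    (hX : MDiffAt (T% X) p.1)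
    (hV : MDiffAt (T% V) p) (hV' : ∀ᶠ q in 𝓝 p, (V q : EM × EK).1 = 0) :
    G.gP.val p (G.gP.leviCivita (G.horizontalLift X) p (U p)) (V p)
      = 1 / 2 * G.covDerivMetric X U V p := by
  have := FiniteDimensional.complete ℝ EM
  have := FiniteDimensional.complete ℝ EK
  have hX' := G.mdiffAt_horizontalLift hX
  have hb : ∀ {A B : Π p : M × K, TangentSpace (IM.prod IK) p}, MDiffAt (T% A) p →
      (∀ᶠ q in 𝓝 p, (A q : EM × EK).1 = 0) → (∀ᶠ q in 𝓝 p, (B q : EM × EK).1 = 0) →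
      G.gP.val p (mlieBracket (IM.prod IK) (G.horizontalLift X) A p) (B p)
        = (G.gK p.1).val p.2 (restrictFibre (mlieBracket (IM.prod IK) (liftBase X) A) p.1 p.2)
            (restrictFibre B p.1 p.2)
          + (G.gK p.1).val p.2 (mlieBracket IK (G.gauge X p.1) (restrictFibre A p.1) p.2)
            (restrictFibre B p.1 p.2) := by
    intro A B hA hA' hB'
    rw [G.gP_apply_vertical (mlieBracket (IM.prod IK) (G.horizontalLift X) A)
      (mlieBracket_projectable_vertical_fst hX' hA hX (fun _ ↦ rfl) hA') hB'.self_of_nhds,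
      G.mlieBracket_horizontalLift_vertical_snd hX hA hA'.self_of_nhds, map_add, add_apply]
  rw [G.gP.val_leviCivita hU hX' hV, SemiRiemannianMetric.koszul,
    (G.ip_vertical_horizontalLift hU').mvfderiv_eq, (G.ip_horizontalLift_vertical hV').mvfderiv_eq,
    mlieBracket_swap_apply (V := U) (W := G.horizontalLift X),
    map_neg, neg_apply, hb hU hU' hV', hb hV hV' hU',
    G.gP_horizontalLift_eq_zero (mlieBracket_vertical_fst hU hV hU' hV'), mvfderiv_const]
  have h1 : mvfderiv (IM.prod IK) (G.gP.ip U V) p (G.horizontalLift X p) = _ :=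
    G.mvfderiv_ip_vertical hU hV hU' hV' (G.horizontalLift X p)
  rw [h1, covDerivMetric, lieDerivBase, lieDerivMetric,
    (G.gK p.1).symm p.2 (restrictFibre U p.1 p.2), (G.gK p.1).symm p.2 (restrictFibre U p.1 p.2)]
  simp only [zero_apply]
  change 1 / 2 * (0 + (mvfderiv (IM.prod IK) _ p (liftBase X p)
    + mvfderiv IK _ p.2 (G.gauge X p.1 p.2)) - _ + _ - _ - _) = _
  ring

/-- The horizontal part of the Levi-Civita connection of the total space along horizontal
directions is that of the base. -/
lemma gP_leviCivita_horizontal_horizontal_horizontal (hX : MDiffAt (T% X) p.1)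
    (hY : MDiffAt (T% Y) p.1) (hZ : MDiffAt (T% Z) p.1) :
    G.gP.val p (G.gP.leviCivita (G.horizontalLift Y) p (G.horizontalLift X p))
        (G.horizontalLift Z p)
      = G.gM.val p.1 (G.gM.leviCivita Y p.1 (X p.1)) (Z p.1) := by
  have := FiniteDimensional.complete ℝ EM
  have := FiniteDimensional.complete ℝ EK
  rw [G.gP.val_leviCivita (G.mdiffAt_horizontalLift hX) (G.mdiffAt_horizontalLift hY)
    (G.mdiffAt_horizontalLift hZ), G.gM.val_leviCivita hX hY hZ]
  have hd : ∀ {X Y Z : Π x : M, TangentSpace IM x}, MDiffAt (T% X) p.1 → MDiffAt (T% Y) p.1 →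
      mvfderiv (IM.prod IK) (G.gP.ip (G.horizontalLift X) (G.horizontalLift Y)) p
        (G.horizontalLift Z p) = mvfderiv IM (G.gM.ip X Y) p.1 (Z p.1) :=
    fun hX hY ↦ G.mvfderiv_ip_horizontalLift hX hY _
  have hb : ∀ {X Y Z : Π x : M, TangentSpace IM x}, MDiffAt (T% X) p.1 → MDiffAt (T% Y) p.1 →
      G.gP.val p (mlieBracket (IM.prod IK) (G.horizontalLift X) (G.horizontalLift Y) p)
        (G.horizontalLift Z p) = G.gM.val p.1 (mlieBracket IM X Y p.1) (Z p.1) := by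
    intro X Y Z hX hY
    refine (G.gP_apply_horizontalLift _).trans ?_
    rw [G.mlieBracket_horizontalLift_fst hX hY]
  rw [SemiRiemannianMetric.koszul, SemiRiemannianMetric.koszul, hd hY hZ, hd hX hZ, hd hX hY,
    hb hX hY, hb hX hZ, hb hY hZ]

/-- Only the term with `[X^H, Y^H]` survives: the lifts have constant inner product along fibres,
and their brackets with `V` are vertical. -/
lemma gP_leviCivita_horizontal_horizontal_vertical (hX : MDiffAt (T% X) p.1)
    (hY : MDiffAt (T% Y) p.1)
    (hV : MDiffAt (T% V) p) (hV' : ∀ᶠ q in 𝓝 p, (V q : EM × EK).1 = 0) :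
    G.gP.val p (G.gP.leviCivita (G.horizontalLift Y) p (G.horizontalLift X p)) (V p)
      = 1 / 2 * (G.gK p.1).val p.2 (G.curvature X Y p) (restrictFibre V p.1 p.2) := by
  have := FiniteDimensional.complete ℝ EM
  have := FiniteDimensional.complete ℝ EK
  have h0 : mvfderiv (IM.prod IK) (G.gP.ip (G.horizontalLift X) (G.horizontalLift Y)) p (V p)
      = 0 := by
    refine (G.mvfderiv_ip_horizontalLift hX hY (V p)).trans ?_
    rw [hV'.self_of_nhds]
    exact map_zero (mvfderiv IM (G.gM.ip X Y) p.1)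
  have hb : ∀ {X Y : Π x : M, TangentSpace IM x}, MDiffAt (T% X) p.1 →
      G.gP.val p (mlieBracket (IM.prod IK) (G.horizontalLift X) V p) (G.horizontalLift Y p)
      = 0 := fun hX ↦ G.gP_horizontalLift_eq_zero
    (mlieBracket_projectable_vertical_fst (G.mdiffAt_horizontalLift hX) hV hX (fun _ ↦ rfl) hV')
  rw [G.gP.val_leviCivita (G.mdiffAt_horizontalLift hX) (G.mdiffAt_horizontalLift hY) hV,
    SemiRiemannianMetric.koszul, h0, (G.ip_horizontalLift_vertical hV').mvfderiv_eq,
    (G.ip_horizontalLift_vertical hV').mvfderiv_eq, hb hX, hb hY,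
    G.gP_mlieBracket_horizontalLift hX hY hV'.self_of_nhds, mvfderiv_const]
  simp only [zero_apply]
  ring

/-- Constancy of `gP(U, V)` removes the derivative of the fibre metric and leaves antisymmetrised
brackets. Those with `X` appear unchanged in formula (2); those with `A(X)` go into the
Kosmann-Lichnerowicz term. -/
lemma gP_leviCivita_horizontal_vertical_vertical (hX : MDiffAt (T% X) p.1)
    (hU : MDiffAt (T% U) p) (hU' : ∀ᶠ q in 𝓝 p, (U q : EM × EK).1 = 0)
    (hV : MDiffAt (T% V) p) (hV' : ∀ᶠ q in 𝓝 p, (V q : EM × EK).1 = 0)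
    {c : ℝ} (hc : G.gP.ip U V =ᶠ[𝓝 p] fun _ ↦ c) :
    G.gP.val p (G.gP.leviCivita U p (G.horizontalLift X p)) (V p)
      = 1 / 2 * (G.gP.val p (mlieBracket (IM.prod IK) (liftBase X) U p) (V p)
          - G.gP.val p (mlieBracket (IM.prod IK) (liftBase X) V p) (U p))
        + 1 / 2 * ((G.gK p.1).val p.2 (mlieBracket IK (G.gauge X p.1) (restrictFibre U p.1) p.2)
            (restrictFibre V p.1 p.2)
          - (G.gK p.1).val p.2 (mlieBracket IK (G.gauge X p.1) (restrictFibre V p.1) p.2)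
            (restrictFibre U p.1 p.2)) := by
  have := FiniteDimensional.complete ℝ EM
  have := FiniteDimensional.complete ℝ EK
  have hX' := G.mdiffAt_horizontalLift hX
  have hb : ∀ {A B : Π p : M × K, TangentSpace (IM.prod IK) p}, MDiffAt (T% A) p →
      (∀ᶠ q in 𝓝 p, (A q : EM × EK).1 = 0) → (∀ᶠ q in 𝓝 p, (B q : EM × EK).1 = 0) →
      G.gP.val p (mlieBracket (IM.prod IK) (G.horizontalLift X) A p) (B p)
        = G.gP.val p (mlieBracket (IM.prod IK) (liftBase X) A p) (B p)
          + (G.gK p.1).val p.2 (mlieBracket IK (G.gauge X p.1) (restrictFibre A p.1) p.2)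
            (restrictFibre B p.1 p.2) := by
    intro A B hA hA' hB'
    rw [G.gP_apply_vertical (mlieBracket (IM.prod IK) (G.horizontalLift X) A)
      (mlieBracket_projectable_vertical_fst hX' hA hX (fun _ ↦ rfl) hA') hB'.self_of_nhds,
      G.gP_apply_vertical (mlieBracket (IM.prod IK) (liftBase X) A)
      (mlieBracket_projectable_vertical_fst (mdiffAt_liftBase hX) hA hX (fun _ ↦ rfl) hA')
      hB'.self_of_nhds,
      G.mlieBracket_horizontalLift_vertical_snd hX hA hA'.self_of_nhds, map_add, add_apply]
  rw [G.gP.val_leviCivita hX' hU hV, SemiRiemannianMetric.koszul, hc.mvfderiv_eq,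
    (G.ip_horizontalLift_vertical hV').mvfderiv_eq, (G.ip_horizontalLift_vertical hU').mvfderiv_eq,
    hb hU hU' hV', hb hV hV' hU',
    G.gP_horizontalLift_eq_zero (mlieBracket_vertical_fst hU hV hU' hV'), mvfderiv_const,
    mvfderiv_const]
  simp only [zero_apply]
  ring

end SubmersiveMetric

/-! ### Gamma matrix identities. -/

section Gamma

open scoped Kronecker

variable {n N N' : Type*} [Fintype n] [DecidableEq n] [Fintype N] [DecidableEq N]
  [Fintype N'] [DecidableEq N'] {ε : n → ℝ} {k : ℕ}

lemma gammaMatrix_mul_self (ρ : CliffordAlgebra (cliffordForm ε) →ₐ[ℝ] Matrix N N ℂ) (i : n) :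
    gammaMatrix ρ i * gammaMatrix ρ i = (-ε i) • (1 : Matrix N N ℂ) := by
  have h : cliffordForm ε (Pi.single i 1) = -ε i := by
    simp [cliffordForm, QuadraticMap.weightedSumSquares_apply, Pi.single_apply]
  rw [gammaMatrix, ← map_mul, CliffordAlgebra.ι_sq_scalar, h, AlgHom.commutes,
    Algebra.algebraMap_eq_smul_one]

lemma gammaMatrix_anticomm (ρ : CliffordAlgebra (cliffordForm ε) →ₐ[ℝ] Matrix N N ℂ) {i j : n}
    (hij : i ≠ j) : gammaMatrix ρ i * gammaMatrix ρ j = -(gammaMatrix ρ j * gammaMatrix ρ i) := by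
  have h : (cliffordForm ε).IsOrtho (Pi.single i 1) (Pi.single j 1) := by
    simp only [QuadraticMap.isOrtho_def, cliffordForm, QuadraticMap.weightedSumSquares_apply,
      ← Finset.sum_add_distrib]
    refine Finset.sum_congr rfl fun l _ ↦ ?_
    by_cases hi : l = i
    · have hj : l ≠ j := hi ▸ hij
      simp [hj]
    · simp [hi]
  rw [gammaMatrix, gammaMatrix, ← map_mul, CliffordAlgebra.ι_mul_ι_comm_of_isOrtho h, map_neg,
    map_mul]

/-- `γ_μ` anticommutes with three of the four factors of `γ₅` and commutes with itself: an odd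
number of signs. -/
lemma gammaFive_mul_gammaMatrix
    (γ : CliffordAlgebra (cliffordForm minkowski) →ₐ[ℝ] Matrix N N ℂ) (μ : Fin 4) :
    gammaFive γ * gammaMatrix γ μ = -(gammaMatrix γ μ * gammaFive γ) := by
  have h : ∀ i j : Fin 4, j < i →
      gammaMatrix γ i * gammaMatrix γ j = -(gammaMatrix γ j * gammaMatrix γ i) :=
    fun i j hij ↦ gammaMatrix_anticomm γ hij.ne'
  -- Together with `hs`, this sorts right-associated words by increasing index and contracts equal
  -- neighbours.
  have h' : ∀ i j : Fin 4, j < i → ∀ x, gammaMatrix γ i * (gammaMatrix γ j * x)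
      = -(gammaMatrix γ j * (gammaMatrix γ i * x)) := fun i j hij x ↦ by
    rw [← mul_assoc, h i j hij, neg_mul, mul_assoc]
  have hs : ∀ i x, gammaMatrix γ i * (gammaMatrix γ i * x) = (-minkowski i) • x := fun i x ↦ by
    rw [← mul_assoc, gammaMatrix_mul_self, smul_mul_assoc, one_mul]
  rw [gammaFive, smul_mul_assoc, mul_smul_comm, ← smul_neg]
  congr 1
  fin_cases μ <;>
  simp [mul_assoc, h 3 0, h 3 1, h 3 2, h' 1 0, h' 2 0, h' 3 0, h' 2 1, h' 3 1,
    h' 3 2, hs, gammaMatrix_mul_self]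

/-- Sorting `γ₀γ₁γ₂γ₃γ₀γ₁γ₂γ₃` takes six transpositions, and the four squares multiply to `1 ·
(-1)³`. The resulting `-1` cancels `i² = -1`. -/
lemma gammaFive_mul_self
    (γ : CliffordAlgebra (cliffordForm minkowski) →ₐ[ℝ] Matrix N N ℂ) :
    gammaFive γ * gammaFive γ = 1 := by
  have h' : ∀ i j : Fin 4, j < i → ∀ x, gammaMatrix γ i * (gammaMatrix γ j * x)
      = -(gammaMatrix γ j * (gammaMatrix γ i * x)) := fun i j hij x ↦ by
    rw [← mul_assoc, gammaMatrix_anticomm γ hij.ne', neg_mul, mul_assoc]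
  rw [gammaFive, smul_mul_smul_comm, Complex.I_mul_I]
  have m0 : minkowski 0 = -1 := rfl
  have m1 : minkowski 1 = 1 := rfl
  have m2 : minkowski 2 = 1 := rfl
  have m3 : minkowski 3 = 1 := rfl
  simp [mul_assoc, h' 1 0, h' 2 0, h' 3 0, h' 2 1, h' 3 1, h' 3 2, gammaMatrix_mul_self,
    m0, m1, m2, m3]

end Gamma

/-! ### Tensor products of spinors. -/

section SpinorTensor

open scoped Kronecker

variable {N N' : Type*} (φ φ' : N → ℂ) (ψ ψ' : N' → ℂ)

lemma spinorTensor_add_left : spinorTensor (φ + φ') ψ = spinorTensor φ ψ + spinorTensor φ' ψ :=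
  funext fun _ ↦ add_mul _ _ _

lemma spinorTensor_add_right : spinorTensor φ (ψ + ψ') = spinorTensor φ ψ + spinorTensor φ ψ' :=
  funext fun _ ↦ mul_add _ _ _

lemma spinorTensor_smul_left (c : ℝ) : spinorTensor (c • φ) ψ = c • spinorTensor φ ψ :=
  funext fun q ↦ smul_mul_assoc c (φ q.1) (ψ q.2)

lemma spinorTensor_smul_right (c : ℝ) : spinorTensor φ (c • ψ) = c • spinorTensor φ ψ :=
  funext fun q ↦ mul_smul_comm c (φ q.1) (ψ q.2)

lemma spinorTensor_neg_left : spinorTensor (-φ) ψ = -spinorTensor φ ψ :=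
  funext fun _ ↦ neg_mul _ _

lemma spinorTensor_sum_left {ι : Type*} (s : Finset ι) (f : ι → N → ℂ) :
    spinorTensor (∑ i ∈ s, f i) ψ = ∑ i ∈ s, spinorTensor (f i) ψ := by
  ext q
  simp [spinorTensor, Finset.sum_mul]

lemma spinorTensor_sum_right {ι : Type*} (s : Finset ι) (f : ι → N' → ℂ) :
    spinorTensor φ (∑ i ∈ s, f i) = ∑ i ∈ s, spinorTensor φ (f i) := by
  ext q
  simp [spinorTensor, Finset.mul_sum]

lemma kronecker_mulVec_spinorTensor [Fintype N] [Fintype N'] (A : Matrix N N ℂ)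
    (B : Matrix N' N' ℂ) :
    (A ⊗ₖ B).mulVec (spinorTensor φ ψ) = spinorTensor (A.mulVec φ) (B.mulVec ψ) := by
  ext q
  simp only [spinorTensor, Matrix.mulVec, dotProduct, Matrix.kroneckerMap_apply,
    Finset.sum_mul_sum, Fintype.sum_prod_type]
  exact Finset.sum_congr rfl fun i _ ↦ Finset.sum_congr rfl fun j _ ↦ by ring

variable [Fintype N'] [Fintype N]

/-- The Leibniz rule for tensor products of spinors. -/
lemma mvfderiv_spinorTensor {E : Type*} [NormedAddCommGroup E] [NormedSpace ℝ E]
    {H : Type*} [TopologicalSpace H] {I : ModelWithCorners ℝ E H}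
    {B : Type*} [TopologicalSpace B] [ChartedSpace H B] {f : B → N → ℂ} {g : B → N' → ℂ} {b : B}
    (hf : MDifferentiableAt I 𝓘(ℝ, N → ℂ) f b) (hg : MDifferentiableAt I 𝓘(ℝ, N' → ℂ) g b)
    (v : TangentSpace I b) :
    mvfderiv I (fun q ↦ spinorTensor (f q) (g q)) b v
      = spinorTensor (mvfderiv I f b v) (g b) + spinorTensor (f b) (mvfderiv I g b v) := by
  let L : (N → ℂ) →ₗ[ℝ] (N' → ℂ) →ₗ[ℝ] (N × N' → ℂ) := LinearMap.mk₂ ℝ spinorTensor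
    spinorTensor_add_left (fun c φ ψ ↦ spinorTensor_smul_left φ ψ c) spinorTensor_add_right
    (fun c φ ψ ↦ spinorTensor_smul_right φ ψ c)
  let T : (N → ℂ) →L[ℝ] (N' → ℂ) →L[ℝ] (N × N' → ℂ) := L.toContinuousBilinearMap
  have hT := T.isBoundedBilinearMap
  have h := mvfderiv_fderiv_comp (T := fun x : (N → ℂ) × (N' → ℂ) ↦ T x.1 x.2)
    (f := fun q ↦ (f q, g q)) (hT.differentiableAt (f b, g b)) (hf.prodMk_space hg) v
  have hfst := mvfderiv_fderiv_comp (T := fun x : (N → ℂ) × (N' → ℂ) ↦ x.1)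
    (f := fun q ↦ (f q, g q)) differentiableAt_fst (hf.prodMk_space hg) v
  have hsnd := mvfderiv_fderiv_comp (T := fun x : (N → ℂ) × (N' → ℂ) ↦ x.2)
    (f := fun q ↦ (f q, g q)) differentiableAt_snd (hf.prodMk_space hg) v
  rw [fderiv_fst] at hfst
  rw [fderiv_snd] at hsnd
  refine h.trans ?_
  rw [hT.fderiv, hfst, hsnd, add_comm]
  rfl

end SpinorTensor

/-! ### The Kosmann-Lichnerowicz derivative through Lie brackets. -/

section Kosmann

variable {E : Type*} [NormedAddCommGroup E] [NormedSpace ℝ E]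
  {H : Type*} [TopologicalSpace H] {I : ModelWithCorners ℝ E H}
  {B : Type*} [TopologicalSpace B] [ChartedSpace H B] [IsManifold I ∞ B]
  {n N : Type*} [Fintype n] [Fintype N]

/-- The Kosmann-Lichnerowicz derivative in terms of Lie brackets with the frame. -/
lemma kosmannDeriv_eq [FiniteDimensional ℝ E] (g : SemiRiemannianMetric I B) (ε : n → ℝ)
    (u : n → Π b : B, TangentSpace I b)
    (Γ : n → Matrix N N ℂ) {X : Π b : B, TangentSpace I b} (Ψ : B → N → ℂ) {b : B}
    (hX : MDiffAt (T% X) b) (hu : ∀ i, MDiffAt (T% (u i)) b) {c : n → n → ℝ}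
    (hc : ∀ i j, g.ip (u i) (u j) =ᶠ[𝓝 b] fun _ ↦ c i j) :
    kosmannDeriv g ε u Γ X Ψ b = mvfderiv I Ψ b (X b) + (1 / 8 : ℝ) • ∑ i, ∑ j,
      (ε i * ε j * (g.val b (mlieBracket I X (u i) b) (u j b)
        - g.val b (mlieBracket I X (u j) b) (u i b))) • (Γ i * Γ j).mulVec (Ψ b) := by
  -- Skewness allows antisymmetrising in `i, j`, and vanishing torsion gives `∇_X u = [X, u] + ∇_u
  -- X`. The correction term of the Kosmann-Lichnerowicz derivative cancels exactly the `∇_u X`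
  -- part, as 1/4 · 1/2 = 1/8.
  have h : ∀ i j, g.val b (g.leviCivita (u i) b (X b)) (u j b)
      = 1 / 2 * (g.val b (mlieBracket I X (u i) b) (u j b)
          - g.val b (mlieBracket I X (u j) b) (u i b))
        + 1 / 2 * (g.val b (g.leviCivita X b (u i b)) (u j b)
          - g.val b (g.leviCivita X b (u j b)) (u i b)) := by
    intro i j
    have h1 := g.val_leviCivita_swap X (hu i) (hu j) (hc i j)
    rw [← g.leviCivita_sub_leviCivita hX (hu i), ← g.leviCivita_sub_leviCivita hX (hu j)]
    simp only [map_sub, sub_apply]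
    linarith
  rw [kosmannDeriv, spinDeriv, add_sub_assoc]
  congr 1
  simp only [h, Finset.smul_sum, ← Finset.sum_sub_distrib, smul_smul, ← sub_smul]
  refine Finset.sum_congr rfl fun i _ ↦ Finset.sum_congr rfl fun j _ ↦ ?_
  congr 1
  ring

lemma mdiffAt_sum_smul {ι : Type*} (s : Finset ι) (c : ι → ℝ) {e : ι → Π b : B, TangentSpace I b}
    {b : B} (he : ∀ a, MDiffAt (T% (e a)) b) : MDiffAt (T% (∑ a ∈ s, c a • e a)) b := by
  classical
  induction s using Finset.induction_on with
  | empty =>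
    exact ((contMDiff_zeroSection ℝ (TangentSpace I : B → Type _)).mdifferentiable
      (n := 1) one_ne_zero) b
  | insert a s ha ih =>
    rw [Finset.sum_insert ha]
    exact mdifferentiableAt_add_section
      (MDifferentiableAt.smul_section (f := fun _ ↦ c a) mdifferentiableAt_const (he a)) ih

lemma mlieBracket_sum_smul_left [FiniteDimensional ℝ E] {ι : Type*} (s : Finset ι) (c : ι → ℝ)
    {e : ι → Π b : B, TangentSpace I b} (V : Π b : B, TangentSpace I b)
    {b : B} (he : ∀ a, MDiffAt (T% (e a)) b) :
    mlieBracket I (∑ a ∈ s, c a • e a) V b = ∑ a ∈ s, c a • mlieBracket I (e a) V b := by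
  classical
  have := FiniteDimensional.complete ℝ E
  induction s using Finset.induction_on with
  | empty => simp
  | insert a s ha ih =>
    have h : MDiffAt (T% (c a • e a)) b :=
      MDifferentiableAt.smul_section (f := fun _ ↦ c a) mdifferentiableAt_const (he a)
    rw [Finset.sum_insert ha, Finset.sum_insert ha,
      mlieBracket_add_left h (mdiffAt_sum_smul s c he), ih, mlieBracket_const_smul_left (he a)]

end Kosmann

/-! ### The adapted frame and the splitting of the spinor derivative. -/

namespace SubmersiveMetric

variable {EM : Type*} [NormedAddCommGroup EM] [NormedSpace ℝ EM]
  {HM : Type*} [TopologicalSpace HM] {IM : ModelWithCorners ℝ EM HM}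
  {M : Type*} [TopologicalSpace M] [ChartedSpace HM M] [IsManifold IM ∞ M]
  {EK : Type*} [NormedAddCommGroup EK] [NormedSpace ℝ EK]
  {HK : Type*} [TopologicalSpace HK] {IK : ModelWithCorners ℝ EK HK}
  {K : Type*} [TopologicalSpace K] [ChartedSpace HK K] [IsManifold IK ∞ K]
  {G : SubmersiveMetric IM M IK K} {k : ℕ} {Idx Idx' : Type*}
  {SM : SpinStructure Idx (fun _ ↦ ⊤) G.gM minkowski}
  {SV : SpinStructure Idx' (vertical IM IK) G.gP (euclidean k)}
  {α : Idx} {β : Idx'} {p : M × K}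

lemma mdiffAt_baseFrame (hα : p.1 ∈ SM.dom α) (μ : Fin 4) : MDiffAt (T% (SM.frame α μ)) p.1 :=
  ((SM.contMDiffOn_frame α μ).contMDiffAt ((SM.isOpen_dom α).mem_nhds hα)).mdifferentiableAt
    (by simp)

lemma mdiffAt_fibreFrame (hβ : p ∈ SV.dom β) (i : Fin k) : MDiffAt (T% (SV.frame β i)) p :=
  ((SV.contMDiffOn_frame β i).contMDiffAt ((SV.isOpen_dom β).mem_nhds hβ)).mdifferentiableAt
    (by simp)

lemma fibreFrame_fst (hβ : p ∈ SV.dom β) (i : Fin k) :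
    ∀ᶠ q in 𝓝 p, (SV.frame β i q : EM × EK).1 = 0 := by
  filter_upwards [(SV.isOpen_dom β).mem_nhds hβ] with q hq
  have h : SV.frame β i q ∈ vertical IM IK q :=
    SV.span_frame β q hq ▸ Submodule.subset_span (mem_range_self i)
  exact h

lemma ip_fibreFrame (hβ : p ∈ SV.dom β) (i j : Fin k) :
    G.gP.ip (SV.frame β i) (SV.frame β j)
      =ᶠ[𝓝 p] fun _ ↦ if i = j then euclidean k i else 0 := by
  filter_upwards [(SV.isOpen_dom β).mem_nhds hβ] with q hq
  exact SV.orthonormal β q hq i j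

lemma ip_restrictFibre_fibreFrame (hβ : p ∈ SV.dom β) (i j : Fin k) :
    (G.gK p.1).ip (restrictFibre (SV.frame β i) p.1) (restrictFibre (SV.frame β j) p.1)
      =ᶠ[𝓝 p.2] fun _ ↦ if i = j then euclidean k i else 0 := by
  have h1 := (G.ip_vertical (fibreFrame_fst hβ i) (fibreFrame_fst hβ j)).symm.trans
    (ip_fibreFrame hβ i j)
  have h2 : Tendsto (fun y : K ↦ (p.1, y)) (𝓝 p.2) (𝓝 p) :=
    (Continuous.prodMk_right p.1).tendsto p.2
  exact h2.eventually h1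

variable {N N' : Type*} [Fintype N] [DecidableEq N] [Fintype N'] [DecidableEq N']
  {γ : CliffordAlgebra (cliffordForm minkowski) →ₐ[ℝ] Matrix N N ℂ}
  {ρ : CliffordAlgebra (cliffordForm (euclidean k)) →ₐ[ℝ] Matrix N' N' ℂ}

lemma mdiffAt_baseSpinor (φ : SpinorField SM γ) (hα : p.1 ∈ SM.dom α) :
    MDifferentiableAt IM 𝓘(ℝ, N → ℂ) (φ.rep α) p.1 :=
  ((φ.contMDiffOn_rep α).contMDiffAt ((SM.isOpen_dom α).mem_nhds hα)).mdifferentiableAt (by simp)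

lemma mdiffAt_fibreSpinor (ψ : SpinorField SV ρ) (hβ : p ∈ SV.dom β) :
    MDifferentiableAt (IM.prod IK) 𝓘(ℝ, N' → ℂ) (ψ.rep β) p :=
  ((ψ.contMDiffOn_rep β).contMDiffAt ((SV.isOpen_dom β).mem_nhds hβ)).mdifferentiableAt (by simp)

variable [FiniteDimensional ℝ EM] [FiniteDimensional ℝ EK]

open scoped Kronecker in
/-- The covariant derivative of `φ^H ⊗ ψ`, split according to the horizontal and vertical frame
vectors. -/
lemma covDeriv_liftTensor (φ : SpinorField SM γ) (ψ : SpinorField SV ρ) (hα : p.1 ∈ SM.dom α)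
    (hβ : p ∈ SV.dom β) (W : Π p : M × K, TangentSpace (IM.prod IK) p) :
    G.covDeriv (G.liftTensor φ ψ) W α β p
      = spinorTensor (mvfderiv IM (φ.rep α) p.1 (W p : EM × EK).1) (ψ.rep β p)
        + spinorTensor (φ.rep α p.1) (mvfderiv (IM.prod IK) (ψ.rep β) p (W p))
        + (1 / 4 : ℝ) • ∑ μ, ∑ ν, (minkowski μ * minkowski ν *
            G.gP.val p (G.gP.leviCivita (G.horizontalLift (SM.frame α μ)) p (W p))
              (G.horizontalLift (SM.frame α ν) p)) •
            spinorTensor ((gammaMatrix γ μ * gammaMatrix γ ν).mulVec (φ.rep α p.1)) (ψ.rep β p)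
        + (1 / 2 : ℝ) • ∑ μ, ∑ i, (minkowski μ *
            G.gP.val p (G.gP.leviCivita (G.horizontalLift (SM.frame α μ)) p (W p))
              (SV.frame β i p)) •
            spinorTensor ((gammaMatrix γ μ * gammaFive γ).mulVec (φ.rep α p.1))
              ((gammaMatrix ρ i).mulVec (ψ.rep β p))
        + (1 / 4 : ℝ) • ∑ i, ∑ j,
            G.gP.val p (G.gP.leviCivita (SV.frame β i) p (W p)) (SV.frame β j p) •
            spinorTensor (φ.rep α p.1)
              ((gammaMatrix ρ i * gammaMatrix ρ j).mulVec (ψ.rep β p)) := by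
  have hd : mvfderiv (IM.prod IK) ((G.liftTensor φ ψ).rep α β) p (W p)
      = spinorTensor (mvfderiv IM (φ.rep α) p.1 (W p : EM × EK).1) (ψ.rep β p)
        + spinorTensor (φ.rep α p.1) (mvfderiv (IM.prod IK) (ψ.rep β) p (W p)) := by
    have h1 := mdiffAt_baseSpinor φ hα
    refine (mvfderiv_spinorTensor (f := fun q : M × K ↦ φ.rep α q.1)
      (h1.comp p mdifferentiableAt_fst) (mdiffAt_fibreSpinor ψ hβ) (W p)).trans ?_
    congr 2
    exact mvfderiv_comp_fst h1 (W p)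
  -- Two signs cancel: one from moving `γ₅` past `γ_μ`, one from skewness of the connection
  -- coefficients. The two mixed sums are therefore equal, and 1/4 becomes 1/2.
  have hvh : ∀ (i : Fin k) (μ : Fin 4),
      (euclidean k i * minkowski μ * G.gP.val p (G.gP.leviCivita (SV.frame β i) p (W p))
        (G.horizontalLift (SM.frame α μ) p)) •
        spinorTensor ((gammaFive γ * gammaMatrix γ μ).mulVec (φ.rep α p.1))
          ((gammaMatrix ρ i).mulVec (ψ.rep β p))
      = (minkowski μ * G.gP.val p (G.gP.leviCivita (G.horizontalLift (SM.frame α μ)) p (W p))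
        (SV.frame β i p)) •
        spinorTensor ((gammaMatrix γ μ * gammaFive γ).mulVec (φ.rep α p.1))
          ((gammaMatrix ρ i).mulVec (ψ.rep β p)) := by
    intro i μ
    rw [gammaFive_mul_gammaMatrix, Matrix.neg_mulVec, spinorTensor_neg_left,
      G.gP.val_leviCivita_swap W (mdiffAt_fibreFrame hβ i)
        (G.mdiffAt_horizontalLift (mdiffAt_baseFrame hα μ))
        (G.ip_vertical_horizontalLift (fibreFrame_fst hβ i)), smul_neg, ← neg_smul]
    congr 1
    simp [euclidean]
  rw [covDeriv, spinDeriv, hd]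
  simp only [Fintype.sum_sum_type, adaptedFrame, gammaProd, Sum.elim_inl, Sum.elim_inr,
    ← Matrix.mul_kronecker_mul, liftTensor, kronecker_mulVec_spinorTensor, gammaFive_mul_self,
    Matrix.one_mulVec, mul_one, one_mul, Finset.sum_add_distrib, hvh]
  rw [Finset.sum_comm (s := (Finset.univ : Finset (Fin k))) (t := (Finset.univ : Finset (Fin 4)))]
  simp only [euclidean, mul_one, one_mul]
  module

end SubmersiveMetric

/-! ### The two derivative formulas. -/

namespace SubmersiveMetric

variable {EM : Type*} [NormedAddCommGroup EM] [NormedSpace ℝ EM]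
  {HM : Type*} [TopologicalSpace HM] {IM : ModelWithCorners ℝ EM HM}
  {M : Type*} [TopologicalSpace M] [ChartedSpace HM M] [IsManifold IM ∞ M]
  {EK : Type*} [NormedAddCommGroup EK] [NormedSpace ℝ EK] [FiniteDimensional ℝ EK]
  {HK : Type*} [TopologicalSpace HK] {IK : ModelWithCorners ℝ EK HK}
  {K : Type*} [TopologicalSpace K] [ChartedSpace HK K] [IsManifold IK ∞ K]
  {G : SubmersiveMetric IM M IK K} {k : ℕ} {Idx Idx' : Type*}
  {SM : SpinStructure Idx (fun _ ↦ ⊤) G.gM minkowski}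
  {SV : SpinStructure Idx' (vertical IM IK) G.gP (euclidean k)}
  {α : Idx} {β : Idx'} {p : M × K}
  {N N' : Type*} [Fintype N] [DecidableEq N] [Fintype N'] [DecidableEq N']
  {γ : CliffordAlgebra (cliffordForm minkowski) →ₐ[ℝ] Matrix N N ℂ}
  {ρ : CliffordAlgebra (cliffordForm (euclidean k)) →ₐ[ℝ] Matrix N' N' ℂ}
  (φ : SpinorField SM γ) (ψ : SpinorField SV ρ)

/-- The covariant derivative of `φ^H ⊗ ψ` along a vertical vector field. -/
lemma covDeriv_liftTensor_vertical [FiniteDimensional ℝ EM] (hα : p.1 ∈ SM.dom α)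
    (hβ : p ∈ SV.dom β)
    {U : Π q : M × K, TangentSpace (IM.prod IK) q} (hU : MDiffAt (T% U) p)
    (hU' : ∀ᶠ q in 𝓝 p, (U q : EM × EK).1 = 0) :
    G.covDeriv (G.liftTensor φ ψ) U α β p
      = spinorTensor (φ.rep α p.1) (G.fibreDeriv ψ (restrictFibre U p.1) β p)
        - (1 / 8 : ℝ) • ∑ μ, ∑ σ, (minkowski μ * minkowski σ *
            (G.gK p.1).val p.2 (G.curvature (SM.frame α μ) (SM.frame α σ) p)
              (restrictFibre U p.1 p.2)) •
            spinorTensor ((gammaMatrix γ μ * gammaMatrix γ σ).mulVec (φ.rep α p.1)) (ψ.rep β p)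
        + (1 / 4 : ℝ) • ∑ μ, ∑ i, (minkowski μ *
            G.covDerivMetric (SM.frame α μ) U (SV.frame β i) p) •
            spinorTensor ((gammaMatrix γ μ * gammaFive γ).mulVec (φ.rep α p.1))
              ((gammaMatrix ρ i).mulVec (ψ.rep β p)) := by
  have hhh := fun μ ν ↦ G.gP_leviCivita_vertical_horizontal_horizontal hU hU'
    (mdiffAt_baseFrame hα μ) (mdiffAt_baseFrame hα ν)
  have hhv := fun μ i ↦ G.gP_leviCivita_vertical_horizontal_vertical hU hU'
    (mdiffAt_baseFrame hα μ) (mdiffAt_fibreFrame hβ i) (fibreFrame_fst hβ i)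
  have hvv := fun i j ↦ G.gP_leviCivita_vertical_vertical_vertical hU (mdiffAt_fibreFrame hβ i)
    (mdiffAt_fibreFrame hβ j) hU' (fibreFrame_fst hβ i) (fibreFrame_fst hβ j)
  -- A basic lift is constant along the fibres.
  have hφ : mvfderiv IM (φ.rep α) p.1 (U p : EM × EK).1 = 0 := by
    rw [hU'.self_of_nhds]
    exact map_zero _
  have hψ : mvfderiv (IM.prod IK) (ψ.rep β) p (U p)
      = mvfderiv IK (fun y ↦ ψ.rep β (p.1, y)) p.2 (restrictFibre U p.1 p.2) := by
    refine (mvfderiv_prod_apply (mdiffAt_fibreSpinor ψ hβ) (U p)).trans ?_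
    rw [hU'.self_of_nhds]
    exact add_eq_right.2 (map_zero _)
  have h0 : spinorTensor (0 : N → ℂ) (ψ.rep β p) = 0 := funext fun _ ↦ zero_mul _
  rw [covDeriv_liftTensor φ ψ hα hβ, hφ, hψ, h0, fibreDeriv, spinDeriv, spinorTensor_add_right,
    spinorTensor_smul_right, spinorTensor_sum_right]
  simp only [hhh, hhv, hvv, spinorTensor_sum_right, spinorTensor_smul_right, euclidean, one_mul]
  -- The connection coefficients contribute factors ∓1/2: the curvature term gets 1/4 · (-1/2) =
  -- -1/8, the mixed term 1/2 · 1/2 = 1/4.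
  have e1 : ∀ (c d : ℝ) (v : N × N' → ℂ), (c * (-(1 / 2) * d)) • v = (-(1 / 2) : ℝ) • (c * d) • v :=
    fun c d v ↦ by module
  have e2 : ∀ (c d : ℝ) (v : N × N' → ℂ), (c * (1 / 2 * d)) • v = (1 / 2 : ℝ) • (c * d) • v :=
    fun c d v ↦ by module
  simp only [e1, e2, ← Finset.smul_sum]
  module

/-- The sum of the Kosmann-Lichnerowicz derivatives along the components of `A(Y)`. -/
lemma sum_fibreKosmann (hβ : p ∈ SV.dom β) {ι : Type*} (e : ι → Π y : K, TangentSpace IK y)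
    (he : ∀ a, MDiffAt (T% (e a)) p.2) (c : ι →₀ ℝ) {Y : Π x : M, TangentSpace IM x}
    (hA : ∀ y : K, G.A (p.1, y) (Y p.1) = c.sum fun a c ↦ c • e a y) :
    (c.sum fun a c ↦ c • G.fibreKosmann ψ (e a) β p)
      = mvfderiv IK (fun y ↦ ψ.rep β (p.1, y)) p.2 (G.gauge Y p.1 p.2)
        + (1 / 8 : ℝ) • ∑ i, ∑ j,
          ((G.gK p.1).val p.2 (mlieBracket IK (G.gauge Y p.1)
                (restrictFibre (SV.frame β i) p.1) p.2) (restrictFibre (SV.frame β j) p.1 p.2)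
            - (G.gK p.1).val p.2 (mlieBracket IK (G.gauge Y p.1)
                (restrictFibre (SV.frame β j) p.1) p.2) (restrictFibre (SV.frame β i) p.1 p.2)) •
            (gammaMatrix ρ i * gammaMatrix ρ j).mulVec (ψ.rep β p) := by
  -- An identity of vector fields on the whole fibre with coefficients independent of `y`, so
  -- brackets acquire no derivatives of coefficients.
  have hg : G.gauge Y p.1 = ∑ a ∈ c.support, c a • e a := by
    ext y
    rw [Finset.sum_apply]
    exact hA y
  have hk : ∀ a, G.fibreKosmann ψ (e a) β p = _ := fun a ↦ kosmannDeriv_eq (G.gK p.1) (euclidean k)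
    (fun j ↦ restrictFibre (SV.frame β j) p.1) (gammaMatrix ρ) (fun y ↦ ψ.rep β (p.1, y)) (he a)
    (fun i ↦ mdiffAt_restrictFibre (mdiffAt_fibreFrame hβ i))
    (fun i j ↦ ip_restrictFibre_fibreFrame hβ i j)
  simp only [Finsupp.sum, hk, hg, mlieBracket_sum_smul_left _ _ _ he, Finset.sum_apply,
    Pi.smul_apply, map_sum, map_smul, sum_apply, smul_apply, smul_add, Finset.sum_add_distrib,
    euclidean, one_mul]
  congr 1
  simp only [Finset.smul_sum, smul_smul, smul_eq_mul, ← Finset.sum_sub_distrib,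
    Finset.sum_smul]
  rw [Finset.sum_comm]
  refine Finset.sum_congr rfl fun i _ ↦ ?_
  rw [Finset.sum_comm]
  refine Finset.sum_congr rfl fun j _ ↦ Finset.sum_congr rfl fun a _ ↦ ?_
  congr 1
  ring

/-- The covariant derivative of `φ^H ⊗ ψ` along a basic horizontal vector field. -/
lemma covDeriv_liftTensor_horizontalLift [FiniteDimensional ℝ EM] (hα : p.1 ∈ SM.dom α)
    (hβ : p ∈ SV.dom β)
    {ι : Type*} (e : ι → Π y : K, TangentSpace IK y) (he : ∀ a, MDiffAt (T% (e a)) p.2)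
    (c : ι →₀ ℝ) {Y : Π x : M, TangentSpace IM x} (hY : MDiffAt (T% Y) p.1)
    (hA : ∀ y : K, G.A (p.1, y) (Y p.1) = c.sum fun a c ↦ c • e a y) :
    G.covDeriv (G.liftTensor φ ψ) (G.horizontalLift Y) α β p
      = spinorTensor (G.baseDeriv φ Y α p.1) (ψ.rep β p)
        + (c.sum fun a c ↦ c • spinorTensor (φ.rep α p.1) (G.fibreKosmann ψ (e a) β p))
        + (1 / 4 : ℝ) • ∑ μ, minkowski μ •
            spinorTensor ((gammaMatrix γ μ * gammaFive γ).mulVec (φ.rep α p.1))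
              (G.fibreClifford ψ β p (G.curvature Y (SM.frame α μ) p))
        + spinorTensor (φ.rep α p.1)
            (mvfderiv (IM.prod IK) (ψ.rep β) p (liftBase Y p)
              + (1 / 8 : ℝ) • ∑ i, ∑ j,
                (G.gP.val p (mlieBracket (IM.prod IK) (liftBase Y) (SV.frame β i) p)
                    (SV.frame β j p)
                  - G.gP.val p (mlieBracket (IM.prod IK) (liftBase Y) (SV.frame β j) p)
                    (SV.frame β i p)) •
                (gammaMatrix ρ i * gammaMatrix ρ j).mulVec (ψ.rep β p)) := by
  have hhh := fun μ ν ↦ G.gP_leviCivita_horizontal_horizontal_horizontal hY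
    (mdiffAt_baseFrame hα μ) (mdiffAt_baseFrame hα ν)
  have hhv := fun μ i ↦ G.gP_leviCivita_horizontal_horizontal_vertical hY
    (mdiffAt_baseFrame hα μ) (mdiffAt_fibreFrame hβ i) (fibreFrame_fst hβ i)
  have hvv := fun i j ↦ G.gP_leviCivita_horizontal_vertical_vertical hY (mdiffAt_fibreFrame hβ i)
    (fibreFrame_fst hβ i) (mdiffAt_fibreFrame hβ j) (fibreFrame_fst hβ j) (ip_fibreFrame hβ i j)
  have hφ : mvfderiv IM (φ.rep α) p.1 (G.horizontalLift Y p : EM × EK).1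
      = mvfderiv IM (φ.rep α) p.1 (Y p.1) := rfl
  -- `Y^H = Y + A(Y)`: the first part gives `∂_Y ψ`, the second is the derivative term of the
  -- Kosmann-Lichnerowicz derivative.
  have hψ : mvfderiv (IM.prod IK) (ψ.rep β) p (G.horizontalLift Y p)
      = mvfderiv (IM.prod IK) (ψ.rep β) p (liftBase Y p)
        + mvfderiv IK (fun y ↦ ψ.rep β (p.1, y)) p.2 (G.gauge Y p.1 p.2) := by
    have h1 := mvfderiv_prod_apply (mdiffAt_fibreSpinor ψ hβ) (G.horizontalLift Y p)
    have h2 := mvfderiv_prod_apply (mdiffAt_fibreSpinor ψ hβ) (liftBase (IK := IK) Y p)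
    have h3 := map_zero (mvfderiv IK (fun y ↦ ψ.rep β (p.1, y)) p.2)
    have key : ∀ a b z : N' → ℂ, z = 0 → a + b = (a + z) + b := by rintro a b _ rfl; simp
    exact (h1.trans (key _ _ _ h3)).trans (congrArg (fun w : N' → ℂ ↦ w +
      mvfderiv IK (fun y ↦ ψ.rep β (p.1, y)) p.2 (G.gauge Y p.1 p.2)) h2.symm)
  have hkos : (c.sum fun a c ↦ c • spinorTensor (φ.rep α p.1) (G.fibreKosmann ψ (e a) β p))
      = spinorTensor (φ.rep α p.1) (c.sum fun a c ↦ c • G.fibreKosmann ψ (e a) β p) := by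
    simp only [Finsupp.sum, spinorTensor_sum_right, spinorTensor_smul_right]
  have hcl : ∀ v : TangentSpace IK p.2, G.fibreClifford ψ β p v
      = ∑ i, (G.gK p.1).val p.2 v (restrictFibre (SV.frame β i) p.1 p.2) •
        (gammaMatrix ρ i).mulVec (ψ.rep β p) := by
    intro v
    simp [fibreClifford, cliffordMul, euclidean, Matrix.sum_mulVec, Matrix.smul_mulVec]
  rw [covDeriv_liftTensor φ ψ hα hβ, hφ, hψ, hkos, sum_fibreKosmann ψ hβ e he c hA, baseDeriv,
    spinDeriv]
  simp only [hhh, hhv, hvv, hcl, spinorTensor_sum_right, spinorTensor_smul_right,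
    spinorTensor_add_right, spinorTensor_sum_left, spinorTensor_smul_left, spinorTensor_add_left]
  -- Here the mixed term gets 1/2 · 1/2 = 1/4, and `e2` separates the brackets with `Y` from those
  -- with `A(Y)`, each with 1/4 · 1/2 = 1/8.
  have e1 : ∀ (d : ℝ) (c : ℝ) (v : N × N' → ℂ), (c * (1 / 2 * d)) • v = (1 / 2 : ℝ) • c • d • v :=
    fun c d v ↦ by module
  have e2 : ∀ (c d : ℝ) (v : N × N' → ℂ), (1 / 2 * c + 1 / 2 * d) • v
      = (1 / 2 : ℝ) • c • v + (1 / 2 : ℝ) • d • v :=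
    fun c d v ↦ by module
  simp only [e1, e2, Finset.sum_add_distrib, ← Finset.smul_sum]
  module

end SubmersiveMetric
theorem mainTheorem4
    {EM : Type*} [NormedAddCommGroup EM] [NormedSpace ℝ EM] [FiniteDimensional ℝ EM]
    {HM : Type*} [TopologicalSpace HM] {IM : ModelWithCorners ℝ EM HM}
    {M : Type*} [TopologicalSpace M] [ChartedSpace HM M] [IsManifold IM ∞ M]
    [BoundarylessManifold IM M]
    {EK : Type*} [NormedAddCommGroup EK] [NormedSpace ℝ EK] [FiniteDimensional ℝ EK]
    {HK : Type*} [TopologicalSpace HK] {IK : ModelWithCorners ℝ EK HK}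
    {K : Type*} [TopologicalSpace K] [ChartedSpace HK K] [IsManifold IK ∞ K]
    [BoundarylessManifold IK K]
    (k : ℕ) (hk : Module.finrank ℝ EK = k)
    (G : SubmersiveMetric IM M IK K)
    {Idx Idx' : Type*}
    (SM : SpinStructure Idx (fun _ ↦ ⊤) G.gM minkowski)
    (SV : SpinStructure Idx' (vertical IM IK) G.gP (euclidean k))
    (γ : CliffordAlgebra (cliffordForm minkowski) →ₐ[ℝ] Matrix (Fin 4) (Fin 4) ℂ)
    (ρ : CliffordAlgebra (cliffordForm (euclidean k)) →ₐ[ℝ]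
      Matrix (Fin (2 ^ (k / 2))) (Fin (2 ^ (k / 2))) ℂ)
    (φ : SpinorField SM γ) (ψ : SpinorField SV ρ)
    {ι : Type*} (e : ι → Π y : K, TangentSpace IK y)
    (he : ∀ a, ContMDiff IK IK.tangent ∞ (fun y ↦ (⟨y, e a y⟩ : TangentBundle IK K)))
    (Acoeff : Π x : M, TangentSpace IM x → ι →₀ ℝ)
    (hA : ∀ (x : M) (v : TangentSpace IM x) (y : K),
      G.A (x, y) v = (Acoeff x v).sum fun a c ↦ c • e a y)
    (α : Idx) (β : Idx') (p : M × K) (hα : p.1 ∈ SM.dom α) (hβ : p ∈ SV.dom β) :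
    (∀ U : Π q : M × K, TangentSpace (IM.prod IK) q,
      ContMDiffAt (IM.prod IK) (IM.prod IK).tangent ∞
        (fun q ↦ (⟨q, U q⟩ : TangentBundle (IM.prod IK) (M × K))) p →
      (∀ q, U q ∈ vertical IM IK q) →
      G.covDeriv (G.liftTensor φ ψ) U α β p
        = spinorTensor (φ.rep α p.1) (G.fibreDeriv ψ (restrictFibre U p.1) β p)
          - (1 / 8 : ℝ) • ∑ μ, ∑ σ, (minkowski μ * minkowski σ *
              (G.gK p.1).val p.2 (G.curvature (SM.frame α μ) (SM.frame α σ) p)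
                (restrictFibre U p.1 p.2)) •
              spinorTensor ((gammaMatrix γ μ * gammaMatrix γ σ).mulVec (φ.rep α p.1)) (ψ.rep β p)
          + (1 / 4 : ℝ) • ∑ μ, ∑ i, (minkowski μ *
              G.covDerivMetric (SM.frame α μ) U (SV.frame β i) p) •
              spinorTensor ((gammaMatrix γ μ * gammaFive γ).mulVec (φ.rep α p.1))
                ((gammaMatrix ρ i).mulVec (ψ.rep β p)))
    ∧ (∀ Y : Π x : M, TangentSpace IM x,
      ContMDiffAt IM IM.tangent ∞ (fun x ↦ (⟨x, Y x⟩ : TangentBundle IM M)) p.1 →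
      G.covDeriv (G.liftTensor φ ψ) (G.horizontalLift Y) α β p
        = spinorTensor (G.baseDeriv φ Y α p.1) (ψ.rep β p)
          + ((Acoeff p.1 (Y p.1)).sum fun a c ↦
              c • spinorTensor (φ.rep α p.1) (G.fibreKosmann ψ (e a) β p))
          + (1 / 4 : ℝ) • ∑ μ, minkowski μ •
              spinorTensor ((gammaMatrix γ μ * gammaFive γ).mulVec (φ.rep α p.1))
                (G.fibreClifford ψ β p (G.curvature Y (SM.frame α μ) p))
          + spinorTensor (φ.rep α p.1)
              (mvfderiv (IM.prod IK) (ψ.rep β) p (liftBase Y p)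
                + (1 / 8 : ℝ) • ∑ i, ∑ j,
                  (G.gP.val p (mlieBracket (IM.prod IK) (liftBase Y) (SV.frame β i) p)
                      (SV.frame β j p)
                    - G.gP.val p (mlieBracket (IM.prod IK) (liftBase Y) (SV.frame β j) p)
                      (SV.frame β i p)) •
                  (gammaMatrix ρ i * gammaMatrix ρ j).mulVec (ψ.rep β p))) := by
  refine ⟨fun U hU hU' ↦ ?_, fun Y hY ↦ ?_⟩
  · exact G.covDeriv_liftTensor_vertical φ ψ hα hβ (hU.mdifferentiableAt (by simp))
      (.of_forall hU')
  · exact SubmersiveMetric.covDeriv_liftTensor_horizontalLift φ ψ hα hβ e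
      (fun a ↦ (he a).mdifferentiableAt (by simp)) (Acoeff p.1 (Y p.1))
      (hY.mdifferentiableAt (by simp)) (hA p.1 (Y p.1))
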